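/- **Setting.** Let $\mathcal Y$ be a finite-dimensional Hilbert space, $\mathcal K\subset\mathcal Y$ a closed convex cone with polar $\mathcal K^\circ$, $X\subset\mathbb R^n$ nonempty, convex and compact, $\mathcal O\supset X$ open and convex, and $\xi$ a random element of a measurable space $\Xi$. Let $F:\mathcal O\times\Xi\to\mathbb R$ and $G:\mathcal O\times\Xi\to\mathcal Y$ be measurable in $\xi$ and such that, for every $\xi\in\Xi$, $F(\cdot,\xi)$ and $G(\cdot,\xi)$ are continuously differentiable on $\mathcal O$, $F(\cdot,\xi)$ is convex on $\mathcal O$, and $x\mapsto G(x,\xi)-\mathcal K$ is graph-convex on $\mathcal O$, i.e. $G((1-\lambda)x^1+\lambda x^2,\xi)-[(1-\lambda)G(x^1,\xi)+\lambda G(x^2,\xi)]\in\mathcal K$ for $x^1,x^2\in\mathcal O$, $\lambda\in[0,1]$. Let $f(x)=\mathbb E[F(x,\xi)]$ (finite on $\mathcal O$) and $g(x)=\mathbb E[G(x,\xi)]$, and consider $\min_{x\in X} f(x)$ subject to $g(x)\in\mathcal K$. For $\sigma>0$ put $$l_\sigma(x,y)=f(x)+\frac1{2\sigma}\left[\|\Pi_{\mathcal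 K^\circ}(y+\sigma g(x))\|^2-\|y\|^2\right],$$ where $\Pi_{\mathcal K^\circ}$ is the metric projection onto $\mathcal K^\circ$. **Algorithm (LSAAL).** Let $\xi_1,\xi_2,\dots$ be the sample sequence, $x^1\in X$ a deterministic point, $y^1=0$. With $l_f^k(x)=F(x^k,\xi_k)+\langle\nabla_xF(x^k,\xi_k),x-x^k\rangle$ and $l_g^k(x)=G(x^k,\xi_k)+\mathrm D_xG(x^k,\xi_k)(x-x^k)$, for $k\ge1$, $$x^{k+1}=\operatorname*{argmin}_{x\in X}\left\{l_f^k(x)+\frac1{2\sigma}\left[\|\Pi_{\mathcal K^\circ}(y^k+\sigma l_g^k(x))\|^2-\|y^k\|^2\right]+\frac1{2\sigma}\|x-x^k\|^2\right\},\qquad y^{k+1}=\Pi_{\mathcal K^\circ}(y^k+\sigma l_g^k(x^{k+1})).$$ **Assumptions.** - (A1) $\xi_1,\xi_2,\dots$ are i.i.d. with the law of $\xi$. - (C1) For all $x\in\mathcal O$, $\nabla f(x)=\mathbb E[\nabla_xF(x,\xi)]$ and $\mathrm Dg(x)=\mathbb E[\mathrm D_xG(x,\xi)]$. - (D1) $R>0$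 and $\|x'-x''\|\le R$ for all $x',x''\in X$. - (D2) $\nu_g>0$ and $\|G(x,\xi)\|\le\nu_g$ for all $x\in\mathcal O$, $\xi\in\Xi$. - (D3) $\kappa_f,\kappa_g>0$ and $\|\nabla_xF(x,\xi)\|\le\kappa_f$, $\|\mathrm D_xG(x,\xi)\|\le\kappa_g$ for all $x\in\mathcal O$, $\xi\in\Xi$. - (D4) (Slater) There is $\hat x\in\operatorname{int}X$ with $g(\hat x)\in\operatorname{int}\mathcal K$. Fix such an $\hat x$ and $\varepsilon_0>0$ such that the closed ball of radius $\varepsilon_0$ about $g(\hat x)$ lies in $\mathcal K$. - (D5) $\nu_f>0$ and $\mathbb E[\exp\{|F(x,\xi)-f(x)|^2/\nu_f^2\}]\le\exp\{1\}$ for all $x\in X$. **Theorem.** Assume the above. Let $N>\nu_g^2\max\{\kappa_g^2,1\}$ be an integer and run the algorithm with $\sigma=1/\sqrt N$. Let $(x^*,y^*)$ be a saddle point of $l_\sigma$ on $X\times\mathcal K^\circ$ (minimised in $x$, maximised in $y$), let $\hat z^N=(\hat x^N,\hat y^N)=\frac1N\sum_{k=1}^N(x^k,y^k)$ and $\epsilon_{l_\sigma}(x,y)=l_\sigma(x,y^*)-l_\sigma(x^*,y)$.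 Then $$\mathrm{Prob}\left[\epsilon_{l_\sigma}(\hat z^N)\le\frac{\varrho_1}{\sqrt N}+\varrho_2\frac{\log N}{\sqrt N}+\varrho_3\frac{\log^2N}{\sqrt N}+\varrho_4\frac{\log N}{N}+\frac{\varrho_5}{N}\right]\ \ge\ 1-\frac5{\sqrt[3]N},$$ where $$\begin{aligned} \beta_0&=\nu_g+\kappa_gR,\qquad \kappa_1=\frac{R^2+2\kappa_fR}{\varepsilon_0},\qquad \kappa_2=\frac{\kappa_f^2+2\nu_g^2+2\kappa_g^2R^2}{\varepsilon_0}-\beta_0,\\ \kappa_3&=2\beta_0+\frac{\varepsilon_0}2+\frac{8\beta_0^2}{\varepsilon_0}\log\frac{32\beta_0^2}{\varepsilon_0^2},\\ \varrho_1&=\tfrac12\beta_0^2+\tfrac12\kappa_f^2+6\nu_g^2+(\|y^*\|+1)\big((\kappa_1+\kappa_3)\kappa_g+\kappa_f+1\big)\kappa_g+\tfrac12(\|y^*\|^2+R^2),\\ \varrho_2&=2\left(\nu_f+\|y^*\|\nu_g+(\kappa_1+\kappa_3)\nu_g+\frac{8\beta_0^2(\|y^*\|+1)\kappa_g^2}{\varepsilon_0}\right),\\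 \varrho_3&=\frac{32\beta_0^2\nu_g}{\varepsilon_0},\qquad \varrho_4=2\kappa_2\nu_g,\qquad \varrho_5=(\|y^*\|+1)\kappa_2\kappa_g^2 . \end{aligned}$$ -/

import Mathlib

open MeasureTheory ProbabilityTheory

/-- The polar cone `K° = {y | ⟨y, k⟩ ≤ 0 for all k ∈ K}`. -/
def polarCone {V : Type*} [NormedAddCommGroup V] [InnerProductSpace ℝ V]
    (K : ProperCone ℝ V) : Set V :=
  {y | ∀ k ∈ K, inner ℝ y k ≤ 0}

/-- A nearest point to `v` in `C`; for `C` nonempty, closed and convex in a finite-dimensional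
space it exists and is unique, and this is the metric projection `Π_C(v)`. -/
noncomputable def metricProj {V : Type*} [NormedAddCommGroup V] (C : Set V) (v : V) : V :=
  Classical.epsilon fun p => p ∈ C ∧ ∀ q ∈ C, ‖p - v‖ ≤ ‖q - v‖

/-- Graph-convexity of the set-valued map `x ↦ h x - K` over `O`, written pointwise. -/
def IsGraphConvexOn {E V : Type*} [AddCommGroup E] [Module ℝ E]
    [NormedAddCommGroup V] [InnerProductSpace ℝ V]
    (K : ProperCone ℝ V) (O : Set E) (h : E → V) : Prop :=
  ∀ x₁ ∈ O, ∀ x₂ ∈ O, ∀ t : ℝ, 0 ≤ t → t ≤ 1 →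
    h ((1 - t) • x₁ + t • x₂) - ((1 - t) • h x₁ + t • h x₂) ∈ K

/-- The expected value `x ↦ 𝔼[H(x, ξ)]`, where `ξ` has law `P`. -/
noncomputable def expVal {E Ξ V : Type*} [MeasurableSpace Ξ]
    [NormedAddCommGroup V] [NormedSpace ℝ V]
    (P : Measure Ξ) (H : E → Ξ → V) (x : E) : V :=
  ∫ s, H x s ∂P

/-- The augmented Lagrangian with parameter `σ` of `min f` subject to `g ∈ K`, that is
`f x + (‖Π_{K°}(y + σ g x)‖² - ‖y‖²) / (2σ)`. -/
noncomputable def augLagrangian {E V : Type*} [NormedAddCommGroup V] [InnerProductSpace ℝ V]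
    (K : ProperCone ℝ V) (σ : ℝ) (f : E → ℝ) (g : E → V) (x : E) (y : V) : ℝ :=
  f x + 1 / (2 * σ) * (‖metricProj (polarCone K) (y + σ • g x)‖ ^ 2 - ‖y‖ ^ 2)

/-- `(x, y)` is a saddle point over `X × Y` of `Φ`, minimised in `x` and maximised in `y`. -/
def IsSaddlePt {E V : Type*} (X : Set E) (Y : Set V) (Φ : E → V → ℝ) (x : E) (y : V) : Prop :=
  x ∈ X ∧ y ∈ Y ∧ ∀ x' ∈ X, ∀ y' ∈ Y, Φ x y' ≤ Φ x y ∧ Φ x y ≤ Φ x' y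

section Algorithm

variable {E V Ξ : Type*} [NormedAddCommGroup E] [InnerProductSpace ℝ E] [CompleteSpace E]
  [NormedAddCommGroup V] [InnerProductSpace ℝ V]

/-- The linearization at `c` of `F(·, s)`. -/
noncomputable def linF (F : E → Ξ → ℝ) (s : Ξ) (c x : E) : ℝ :=
  F c s + inner ℝ (gradient (fun u => F u s) c) (x - c)

/-- The linearization at `c` of `G(·, s)`. -/
noncomputable def linG (G : E → Ξ → V) (s : Ξ) (c x : E) : V :=
  G c s + fderiv ℝ (fun u => G u s) c (x - c)

/-- `x` and `y` are the iterates of the linearized stochastic approximation augmented Lagrange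
method along the sample sequence `ξ`, started at `x₁` and at the multiplier `0`.
Numbering starts at `0`: `x k`, `y k`, `ξ k` are the iterates and the sample with number `k + 1`. -/
structure IsLSAALRun (F : E → Ξ → ℝ) (G : E → Ξ → V) (X : Set E) (K : ProperCone ℝ V)
    (σ : ℝ) (x₁ : E) (ξ : ℕ → Ξ) (x : ℕ → E) (y : ℕ → V) : Prop where
  x_init : x 0 = x₁
  y_init : y 0 = 0
  x_mem : ∀ k, x (k + 1) ∈ X
  x_step : ∀ k, IsMinOn
    (fun u => augLagrangian K σ (linF F (ξ k) (x k)) (linG G (ξ k) (x k)) u (y k)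
      + 1 / (2 * σ) * ‖u - x k‖ ^ 2) X (x (k + 1))
  y_step : ∀ k, y (k + 1) =
    metricProj (polarCone K) (y k + σ • linG G (ξ k) (x k) (x (k + 1)))

end Algorithm

/-- The minimax optimality measure at `(x, y)` relative to the saddle point `(xs, ys)`. -/
def minimaxGap {E V : Type*} (Φ : E → V → ℝ) (xs : E) (ys : V) (x : E) (y : V) : ℝ :=
  Φ x ys - Φ xs y

/-- The average of the first `N` terms of a sequence. -/
noncomputable def avgIter {V : Type*} [AddCommGroup V] [Module ℝ V] (N : ℕ) (v : ℕ → V) : V :=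
  (1 / (N : ℝ)) • ∑ k ∈ Finset.range N, v k

section Constants

/-- `β₀ = ν_g + κ_g R`. -/
def constBeta (R νg κg : ℝ) : ℝ := νg + κg * R

/-- `κ₁ = (R² + 2 κ_f R) / ε₀`. -/
noncomputable def constKappa1 (R κf ε₀ : ℝ) : ℝ := (R ^ 2 + 2 * κf * R) / ε₀

/-- `κ₂ = (κ_f² + 2 ν_g² + 2 κ_g² R²) / ε₀ - β₀`. -/
noncomputable def constKappa2 (R νg κf κg ε₀ : ℝ) : ℝ :=
  (κf ^ 2 + 2 * νg ^ 2 + 2 * κg ^ 2 * R ^ 2) / ε₀ - constBeta R νg κg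

/-- `κ₃ = 2 β₀ + ε₀ / 2 + 8 β₀² log (32 β₀² / ε₀²) / ε₀`. -/
noncomputable def constKappa3 (R νg κg ε₀ : ℝ) : ℝ :=
  2 * constBeta R νg κg + ε₀ / 2
    + 8 * constBeta R νg κg ^ 2 * Real.log (32 * constBeta R νg κg ^ 2 / ε₀ ^ 2) / ε₀

/-- `ϱ₁`; the last argument `η` stands for `‖y*‖`. -/
noncomputable def constRho1 (R νg κf κg ε₀ η : ℝ) : ℝ :=
  (constBeta R νg κg ^ 2 / 2 + κf ^ 2 / 2 + 6 * νg ^ 2)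
    + (η + 1) * ((constKappa1 R κf ε₀ + constKappa3 R νg κg ε₀) * κg + κf + 1) * κg
    + (η ^ 2 + R ^ 2) / 2

/-- `ϱ₂`. -/
noncomputable def constRho2 (R νf νg κf κg ε₀ η : ℝ) : ℝ :=
  2 * (νf + η * νg + (constKappa1 R κf ε₀ + constKappa3 R νg κg ε₀) * νg
    + 8 * constBeta R νg κg ^ 2 * (η + 1) * κg ^ 2 / ε₀)

/-- `ϱ₃`. -/
noncomputable def constRho3 (R νg κg ε₀ : ℝ) : ℝ :=
  32 * constBeta R νg κg ^ 2 * νg / ε₀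

/-- `ϱ₄`. -/
noncomputable def constRho4 (R νg κf κg ε₀ : ℝ) : ℝ :=
  2 * constKappa2 R νg κf κg ε₀ * νg

/-- `ϱ₅`. -/
noncomputable def constRho5 (R νg κf κg ε₀ η : ℝ) : ℝ :=
  (η + 1) * constKappa2 R νg κf κg ε₀ * κg ^ 2

end Constants

/-! ### Projection onto the polar cone and the augmented penalty. -/

section Projection

variable {V : Type*} [NormedAddCommGroup V] [InnerProductSpace ℝ V] {K : ProperCone ℝ V}

/-! The penalty at `(y, u)` is the maximum over polar `v` of `⟨v, u⟩ - ‖v - y‖² / (2σ)`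
(`augPenalty_eq`, `le_augPenalty`). For polar `y` it therefore lies between `⟨y, u⟩` and `⟨y, u⟩ +
σ‖u‖² / 2`, and by convexity the minimax gap at the averages exceeds the mean of the ordinary
Lagrangian gaps by at most `σ νg² / 2` (`minimaxGap_avgIter_le`). Each such gap is its sampled
version plus a noise term `stepError`.

The sampled gaps telescope: strong convexity of the proximal subproblem and strong concavity of the
penalty's dual form make `‖y* - y k‖² + ‖x* - x k‖²` a potential (`sum_saddle_le`). With `σ = 1/√N`
the mean of the remainders is of order `1/√N`, up to the size of the multipliers.

The noise is conditionally centred, but its scale involves `‖y k‖`, which has no deterministic bound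
of the right order. Its tail comes from a drift argument for `w = √(‖y‖² + ‖xhat - x‖²)`. The Slater
condition gives `⟨y, G xhat⟩` mean at most `-ε₀‖y‖`, so above a threshold `θ` the exponential moment
of `w` does not grow, and below it the next value is at most `θ + 2β₀`. Moments thus grow only
linearly in `k` (`lintegral_exp_drift_le`), and a union bound keeps all `‖y k‖` below a level `B` of
order `log N`, except with probability `N⁻²` (`measure_exists_le_norm_y`).

Truncating the multiplier at `B` gives noise of fixed scale, and Markov's inequality for its
exponential bounds the sum except with probability `e²/N` (`measure_sum_stepError`). Outside both
events the truncation is inactive and the estimates add up to the claimed constants. -/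

theorem zero_mem_polarCone : (0 : V) ∈ polarCone K := fun k _ => by simp

theorem add_mem_polarCone {u v : V} (hu : u ∈ polarCone K) (hv : v ∈ polarCone K) :
    u + v ∈ polarCone K := fun k hk => by
  rw [inner_add_left]; linarith [hu k hk, hv k hk]

theorem smul_mem_polarCone {v : V} (hv : v ∈ polarCone K) {c : ℝ} (hc : 0 ≤ c) :
    c • v ∈ polarCone K := fun k hk => by
  rw [real_inner_smul_left]; exact mul_nonpos_of_nonneg_of_nonpos hc (hv k hk)

theorem convex_polarCone : Convex ℝ (polarCone K) := fun _ hu _ hv _ _ ha hb _ =>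
  add_mem_polarCone (smul_mem_polarCone hu ha) (smul_mem_polarCone hv hb)

theorem isClosed_polarCone : IsClosed (polarCone K) := by
  have : polarCone K = ⋂ k ∈ K, {y : V | inner ℝ y k ≤ 0} := by
    ext; simp [polarCone]
  rw [this]
  exact isClosed_biInter fun k _ => isClosed_le (by fun_prop) continuous_const

theorem avgIter_mem_polarCone {N : ℕ} {v : ℕ → V} (hv : ∀ k, v k ∈ polarCone K) :
    avgIter N v ∈ polarCone K := by
  refine smul_mem_polarCone ?_ (by positivity)
  induction N with
  | zero => simpa using zero_mem_polarCone
  | succ n ih => rw [Finset.sum_range_succ]; exact add_mem_polarCone ih (hv n)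

/-- If the ball of radius `ε` about `g` lies in `K`, then `⟨v, g⟩ ≤ -ε ‖v‖` on the polar cone. -/
theorem inner_le_of_closedBall_subset {g : V} {ε : ℝ} (hε : 0 < ε)
    (h : Metric.closedBall g ε ⊆ (K : Set V)) {v : V} (hv : v ∈ polarCone K) :
    inner ℝ v g ≤ -(ε * ‖v‖) := by
  rcases eq_or_ne v 0 with rfl | h0
  · simp
  have hn : 0 < ‖v‖ := norm_pos_iff.2 h0
  have hmem : g + (ε / ‖v‖) • v ∈ K := h (by
    rw [mem_closedBall_iff_norm, add_sub_cancel_left, norm_smul, Real.norm_of_nonneg (by positivity)]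
    field_simp; rfl)
  have := hv _ hmem
  rw [inner_add_right, real_inner_smul_right, real_inner_self_eq_norm_sq] at this
  have e : ε / ‖v‖ * ‖v‖ ^ 2 = ε * ‖v‖ := by field_simp
  linarith

variable [FiniteDimensional ℝ V]

theorem metricProj_polarCone_spec (K : ProperCone ℝ V) (z : V) :
    metricProj (polarCone K) z ∈ polarCone K ∧
      ∀ q ∈ polarCone K, ‖metricProj (polarCone K) z - z‖ ≤ ‖q - z‖ := by
  have hne : (polarCone K).Nonempty := ⟨0, zero_mem_polarCone⟩
  have : ProperSpace V := FiniteDimensional.proper ℝ V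
  obtain ⟨p, hp, hmin⟩ := isClosed_polarCone (K := K).exists_infDist_eq_dist hne z
  refine Classical.epsilon_spec (p := fun p => p ∈ polarCone K ∧
    ∀ q ∈ polarCone K, ‖p - z‖ ≤ ‖q - z‖) ⟨p, hp, fun q hq => ?_⟩
  have := Metric.infDist_le_dist_of_mem (x := z) hq
  rw [hmin] at this
  rwa [dist_comm, dist_comm z q, dist_eq_norm, dist_eq_norm] at this

theorem metricProj_mem (K : ProperCone ℝ V) (z : V) : metricProj (polarCone K) z ∈ polarCone K :=
  (metricProj_polarCone_spec K z).1

theorem inner_sub_metricProj_sub_nonpos (z : V) {v : V} (hv : v ∈ polarCone K) :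
    inner ℝ (z - metricProj (polarCone K) z) (v - metricProj (polarCone K) z) ≤ 0 := by
  obtain ⟨hp, hmin⟩ := metricProj_polarCone_spec K z
  refine (norm_eq_iInf_iff_real_inner_le_zero convex_polarCone hp).1 ?_ v hv
  have : Nonempty (polarCone K) := ⟨⟨0, zero_mem_polarCone⟩⟩
  refine le_antisymm (le_ciInf fun w => ?_) (ciInf_le ⟨0, ?_⟩ (⟨_, hp⟩ : polarCone K))
  · rw [norm_sub_rev, norm_sub_rev z]; exact hmin w w.2
  · rintro _ ⟨w, rfl⟩; exact norm_nonneg _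

theorem inner_sub_metricProj_self (K : ProperCone ℝ V) (z : V) :
    inner ℝ (z - metricProj (polarCone K) z) (metricProj (polarCone K) z) = 0 := by
  have h0 := inner_sub_metricProj_sub_nonpos z (zero_mem_polarCone (K := K))
  have h2 := inner_sub_metricProj_sub_nonpos z
    (smul_mem_polarCone (metricProj_mem K z) (zero_le_two (α := ℝ)))
  rw [inner_sub_right, inner_zero_right] at h0
  rw [two_smul, add_sub_cancel_right] at h2
  linarith

theorem inner_sub_metricProj_nonpos (z : V) {v : V} (hv : v ∈ polarCone K) :
    inner ℝ (z - metricProj (polarCone K) z) v ≤ 0 := by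
  have h := inner_sub_metricProj_sub_nonpos z hv
  rw [inner_sub_right, inner_sub_metricProj_self] at h
  linarith

theorem norm_metricProj_sub_le (K : ProperCone ℝ V) (z w : V) :
    ‖metricProj (polarCone K) z - metricProj (polarCone K) w‖ ≤ ‖z - w‖ := by
  set p := metricProj (polarCone K) z
  set q := metricProj (polarCone K) w
  have h1 := inner_sub_metricProj_sub_nonpos z (metricProj_mem K w)
  have h2 := inner_sub_metricProj_sub_nonpos w (metricProj_mem K z)
  have h3 : ‖p - q‖ ^ 2 ≤ inner ℝ (z - w) (p - q) := by
    rw [← real_inner_self_eq_norm_sq]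
    have : inner ℝ (z - w) (p - q) - inner ℝ (p - q) (p - q)
        = -(inner ℝ (z - p) (q - p) + inner ℝ (w - q) (p - q)) := by
      simp only [inner_sub_left, inner_sub_right]; ring
    linarith
  have h4 := real_inner_le_norm (z - w) (p - q)
  by_contra! h
  have := norm_nonneg (z - w)
  nlinarith

theorem continuous_metricProj (K : ProperCone ℝ V) : Continuous (metricProj (polarCone K)) :=
  (LipschitzWith.of_dist_le_mul (K := 1) fun z w => by
    simpa [dist_eq_norm] using norm_metricProj_sub_le K z w).continuous

theorem norm_metricProj_le (K : ProperCone ℝ V) (z : V) : ‖metricProj (polarCone K) z‖ ≤ ‖z‖ := by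
  have h := inner_sub_metricProj_self K z
  rw [inner_sub_left, real_inner_self_eq_norm_sq] at h
  have h4 := real_inner_le_norm z (metricProj (polarCone K) z)
  by_contra! h'
  have := norm_nonneg z
  nlinarith

/-- The penalty term of the augmented Lagrangian as a function of the constraint value. -/
noncomputable def augPenalty (K : ProperCone ℝ V) (σ : ℝ) (y u : V) : ℝ :=
  1 / (2 * σ) * (‖metricProj (polarCone K) (y + σ • u)‖ ^ 2 - ‖y‖ ^ 2)

theorem Continuous.augPenalty {α : Type*} [TopologicalSpace α] {f g : α → V} (hf : Continuous f)
    (hg : Continuous g) (σ : ℝ) : Continuous fun a => augPenalty K σ (f a) (g a) := by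
  have h := (continuous_metricProj K).comp (hf.add (hg.const_smul σ))
  exact continuous_const.mul ((h.norm.pow 2).sub (hf.norm.pow 2))

variable {σ : ℝ}

/-- The value of the dual form at its maximiser `Π(y + σu)`; it follows from the orthogonality of
the projection and its residual. -/
theorem augPenalty_eq (hσ : 0 < σ) (y u : V) :
    augPenalty K σ y u = inner ℝ (metricProj (polarCone K) (y + σ • u)) u
      - 1 / (2 * σ) * ‖metricProj (polarCone K) (y + σ • u) - y‖ ^ 2 := by
  have h := inner_sub_metricProj_self K (y + σ • u)
  unfold augPenalty
  set p := metricProj (polarCone K) (y + σ • u)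
  rw [inner_sub_left, inner_add_left, real_inner_smul_left, real_inner_self_eq_norm_sq,
    real_inner_comm p u, real_inner_comm p y] at h
  rw [norm_sub_sq_real]
  have : σ * inner ℝ p u = ‖p‖ ^ 2 - inner ℝ p y := by linarith
  field_simp
  linarith

/-- The dual objective is strongly concave, so a competitor falls short by at least its squared
distance to the maximiser. That square is what telescopes in the multipliers. -/
theorem le_augPenalty (hσ : 0 < σ) (y u : V) {v : V} (hv : v ∈ polarCone K) :
    inner ℝ v u - 1 / (2 * σ) * ‖v - y‖ ^ 2
      + 1 / (2 * σ) * ‖v - metricProj (polarCone K) (y + σ • u)‖ ^ 2 ≤ augPenalty K σ y u := by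
  have h := inner_sub_metricProj_nonpos (y + σ • u) hv
  unfold augPenalty
  set p := metricProj (polarCone K) (y + σ • u)
  rw [inner_sub_left, inner_add_left, real_inner_smul_left,
    real_inner_comm v u, real_inner_comm v y, real_inner_comm v p] at h
  rw [norm_sub_sq_real, norm_sub_sq_real, ← sub_nonneg]
  have : 1 / (2 * σ) * (‖p‖ ^ 2 - ‖y‖ ^ 2) - (inner ℝ v u
      - 1 / (2 * σ) * (‖v‖ ^ 2 - 2 * inner ℝ v y + ‖y‖ ^ 2)
      + 1 / (2 * σ) * (‖v‖ ^ 2 - 2 * inner ℝ v p + ‖p‖ ^ 2))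
      = -(1 / σ * (inner ℝ v y + σ * inner ℝ v u - inner ℝ v p)) := by
    field_simp; ring
  rw [this]
  have : 0 < 1 / σ := by positivity
  nlinarith

theorem inner_le_augPenalty (hσ : 0 < σ) {y : V} (u : V) (hy : y ∈ polarCone K) :
    inner ℝ y u ≤ augPenalty K σ y u := by
  have h := le_augPenalty hσ y u hy
  have : 0 ≤ 1 / (2 * σ) * ‖y - metricProj (polarCone K) (y + σ • u)‖ ^ 2 := by positivity
  simp only [sub_self, norm_zero] at h
  linarith

theorem augPenalty_le (hσ : 0 < σ) (y u : V) :
    augPenalty K σ y u ≤ inner ℝ y u + σ / 2 * ‖u‖ ^ 2 := by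
  rw [augPenalty_eq hσ]
  set p := metricProj (polarCone K) (y + σ • u)
  have h : inner ℝ p u = inner ℝ y u + inner ℝ (p - y) u := by rw [inner_sub_left]; ring
  have h4 := real_inner_le_norm (p - y) u
  have h5 : ‖p - y‖ * ‖u‖ ≤ σ / 2 * ‖u‖ ^ 2 + 1 / (2 * σ) * ‖p - y‖ ^ 2 := by
    rw [← sub_nonneg]
    have : σ / 2 * ‖u‖ ^ 2 + 1 / (2 * σ) * ‖p - y‖ ^ 2 - ‖p - y‖ * ‖u‖
      = 1 / (2 * σ) * (σ * ‖u‖ - ‖p - y‖) ^ 2 := by field_simp; ring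
    rw [this]; positivity
  linarith

/-- Only the maximiser for `u` needs testing at `w`. The order is the one graph-convexity provides,
so a linearized constraint can be replaced by the true one. -/
theorem augPenalty_mono (hσ : 0 < σ) (y : V) {u w : V}
    (h : ∀ v ∈ polarCone K, inner ℝ v u ≤ inner ℝ v w) :
    augPenalty K σ y u ≤ augPenalty K σ y w := by
  have hp := metricProj_mem K (y + σ • u)
  rw [augPenalty_eq hσ]
  refine le_trans (sub_le_sub_right (h _ hp) _) (le_trans ?_ (le_augPenalty hσ y w hp))
  refine le_add_of_nonneg_right ?_
  positivity

theorem convexOn_augPenalty (hσ : 0 < σ) (y : V) :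
    ConvexOn ℝ Set.univ (augPenalty K σ y) := by
  refine ⟨convex_univ, fun u _ w _ a b ha hb hab => ?_⟩
  have hp := metricProj_mem K (y + σ • (a • u + b • w))
  rw [augPenalty_eq hσ]
  set p := metricProj (polarCone K) (y + σ • (a • u + b • w))
  have hu := le_augPenalty hσ y u hp
  have hw := le_augPenalty hσ y w hp
  have h1 : inner ℝ p u - 1 / (2 * σ) * ‖p - y‖ ^ 2 ≤ augPenalty K σ y u := by
    refine le_trans (le_add_of_nonneg_right ?_) hu; positivity
  have h2 : inner ℝ p w - 1 / (2 * σ) * ‖p - y‖ ^ 2 ≤ augPenalty K σ y w := by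
    refine le_trans (le_add_of_nonneg_right ?_) hw; positivity
  rw [inner_add_right, real_inner_smul_right, real_inner_smul_right, smul_eq_mul, smul_eq_mul]
  obtain rfl : b = 1 - a := by linarith
  nlinarith [mul_le_mul_of_nonneg_left h1 ha, mul_le_mul_of_nonneg_left h2 hb]

end Projection

/-! ### Gradient inequality and growth at proximal minimizers. -/

section Convexity

variable {E : Type*} [NormedAddCommGroup E] [NormedSpace ℝ E]

theorem ConvexOn.add_fderiv_sub_le {s : Set E} {φ : E → ℝ} (hφ : ConvexOn ℝ s φ) {c x : E}
    {φ' : E →L[ℝ] ℝ} (hd : HasFDerivAt φ φ' c) (hc : c ∈ s) (hx : x ∈ s) :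
    φ c + φ' (x - c) ≤ φ x := by
  have hline := hφ.comp_affineMap (AffineMap.lineMap c x)
  have hder : HasDerivAt (φ ∘ (AffineMap.lineMap c x : ℝ →ᵃ[ℝ] E)) (φ' (x - c)) 0 := by
    have h1 : HasDerivAt (AffineMap.lineMap c x : ℝ → E) (x - c) 0 :=
      AffineMap.hasDerivAt_lineMap
    exact HasFDerivAt.comp_hasDerivAt (0 : ℝ) (by simpa using hd) h1
  have := hline.le_slope_of_hasDerivAt (x := 0) (y := 1) (by simpa using hc) (by simpa using hx)
    one_pos hder
  simp [slope_def_field] at this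
  rw [map_sub]; linarith

/-- Quadratic growth at a minimizer of a proximal subproblem. -/
theorem IsMinOn.add_sq_le_of_convexOn {E : Type*} [NormedAddCommGroup E] [InnerProductSpace ℝ E]
    {X : Set E} {q : E → ℝ} (hq : ConvexOn ℝ X q) {a : ℝ} {c p : E}
    (hp : p ∈ X) (hmin : IsMinOn (fun u => q u + a * ‖u - c‖ ^ 2) X p) {u : E} (hu : u ∈ X) :
    q p + a * ‖p - c‖ ^ 2 + a * ‖u - p‖ ^ 2 ≤ q u + a * ‖u - c‖ ^ 2 := by
  set D := q u + a * ‖u - c‖ ^ 2 - (q p + a * ‖p - c‖ ^ 2) with hD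
  -- Minimality is tested on the segment from `p` to `u`; after division by `t`, the limit `t → 0`
  -- recovers the full square.
  have key : ∀ t : ℝ, 0 < t → t < 1 → (1 - t) * (a * ‖u - p‖ ^ 2) ≤ D := by
    intro t ht0 ht1
    have hmem := hq.1 hp hu (sub_nonneg.2 ht1.le) ht0.le (by ring)
    have hconv := hq.2 hp hu (sub_nonneg.2 ht1.le) ht0.le (by ring)
    have h1 := isMinOn_iff.1 hmin _ hmem
    have h2 : ‖(1 - t) • p + t • u - c‖ ^ 2
        = (1 - t) * ‖p - c‖ ^ 2 + t * ‖u - c‖ ^ 2 - t * (1 - t) * ‖u - p‖ ^ 2 := by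
      have e1 : (1 - t) • p + t • u - c = (p - c) + t • (u - p) := by module
      have e2 : u - c = (p - c) + (u - p) := by abel
      rw [e1, e2, norm_add_sq_real, norm_add_sq_real, real_inner_smul_right, norm_smul,
        Real.norm_of_nonneg ht0.le]
      ring
    simp only [smul_eq_mul] at hconv
    rw [h2] at h1
    have : t * ((1 - t) * (a * ‖u - p‖ ^ 2)) ≤ t * D := by rw [hD]; linarith
    exact le_of_mul_le_mul_left this ht0
  have hlim : Filter.Tendsto (fun t : ℝ => (1 - t) * (a * ‖u - p‖ ^ 2)) (nhdsWithin 0 (Set.Ioi 0))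
      (nhds ((1 - 0) * (a * ‖u - p‖ ^ 2))) :=
    (Continuous.tendsto (by fun_prop) 0).mono_left nhdsWithin_le_nhds
  have := le_of_tendsto hlim (b := D) (by
    filter_upwards [Ioo_mem_nhdsGT (zero_lt_one (α := ℝ))] with t ht using key t ht.1 ht.2)
  linarith

end Convexity

/-! ### Deterministic estimates along one run. -/

section Run

variable {E V Ξ : Type*} [NormedAddCommGroup E] [InnerProductSpace ℝ E] [CompleteSpace E]
  [NormedAddCommGroup V] [InnerProductSpace ℝ V]

/-- The convexity, smoothness and boundedness hypotheses on the sampled functions `F` and `G`. -/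
structure IsBoundedConvexSample (F : E → Ξ → ℝ) (G : E → Ξ → V) (X O : Set E)
    (K : ProperCone ℝ V) (R νg κf κg : ℝ) : Prop where
  convex : Convex ℝ X
  isOpen : IsOpen O
  convex_domain : Convex ℝ O
  subset : X ⊆ O
  convexOn : ∀ s, ConvexOn ℝ O (fun x => F x s)
  graphConvexOn : ∀ s, IsGraphConvexOn K O (fun x => G x s)
  contDiffOn_F : ∀ s, ContDiffOn ℝ 1 (fun x => F x s) O
  contDiffOn_G : ∀ s, ContDiffOn ℝ 1 (fun x => G x s) O
  diam_le : ∀ x ∈ X, ∀ x' ∈ X, ‖x - x'‖ ≤ R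
  norm_G_le : ∀ s, ∀ x ∈ O, ‖G x s‖ ≤ νg
  norm_gradient_le : ∀ s, ∀ x ∈ O, ‖gradient (fun u => F u s) x‖ ≤ κf
  norm_fderiv_le : ∀ s, ∀ x ∈ O, ‖fderiv ℝ (fun u => G u s) x‖ ≤ κg

theorem inner_gradient_eq_fderiv (f : E → ℝ) (c v : E) :
    inner ℝ (gradient f c) v = fderiv ℝ f c v :=
  InnerProductSpace.toDual_symm_apply

theorem linF_sub (F : E → Ξ → ℝ) (s : Ξ) (c u p : E) :
    linF F s c u - linF F s c p = inner ℝ (gradient (fun u => F u s) c) (u - p) := by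
  have : u - p = (u - c) - (p - c) := by abel
  rw [linF, linF, this, inner_sub_right _ (u - c)]; ring

theorem linF_self (F : E → Ξ → ℝ) (s : Ξ) (c : E) : linF F s c c = F c s := by simp [linF]

omit [CompleteSpace E] in
theorem linG_self (G : E → Ξ → V) (s : Ξ) (c : E) : linG G s c c = G c s := by simp [linG]

omit [CompleteSpace E] in
theorem linG_combo (G : E → Ξ → V) (s : Ξ) (c u w : E) {a b : ℝ} (h : a + b = 1) :
    linG G s c (a • u + b • w) = a • linG G s c u + b • linG G s c w := by
  obtain rfl : b = 1 - a := by linarith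
  have : a • u + (1 - a) • w - c = a • (u - c) + (1 - a) • (w - c) := by module
  rw [linG, linG, linG, this, map_add, map_smul, map_smul]
  module

theorem linF_combo (F : E → Ξ → ℝ) (s : Ξ) (c u w : E) {a b : ℝ} (h : a + b = 1) :
    linF F s c (a • u + b • w) = a * linF F s c u + b * linF F s c w := by
  obtain rfl : b = 1 - a := by linarith
  have : a • u + (1 - a) • w - c = a • (u - c) + (1 - a) • (w - c) := by module
  rw [linF, linF, linF, this, inner_add_right, real_inner_smul_right, real_inner_smul_right]
  ring

omit [CompleteSpace E] in
theorem IsGraphConvexOn.convexOn_inner {K : ProperCone ℝ V} {O : Set E} {h : E → V}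
    (hh : IsGraphConvexOn K O h) (hO : Convex ℝ O) {v : V} (hv : v ∈ polarCone K) :
    ConvexOn ℝ O (fun x => inner ℝ v (h x)) := by
  refine ⟨hO, fun x hx w hw a b ha hb hab => ?_⟩
  obtain rfl : a = 1 - b := by linarith
  have := hv _ (hh x hx w hw b hb (by linarith))
  rw [inner_sub_right, inner_add_right, real_inner_smul_right, real_inner_smul_right] at this
  simpa using this

variable {F : E → Ξ → ℝ} {G : E → Ξ → V} {X O : Set E} {K : ProperCone ℝ V} {R νg κf κg : ℝ}
  (H : IsBoundedConvexSample F G X O K R νg κf κg)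
include H

namespace IsBoundedConvexSample

theorem linF_le {s : Ξ} {c x : E} (hc : c ∈ O) (hx : x ∈ O) : linF F s c x ≤ F x s := by
  have hd : HasFDerivAt (fun u => F u s) (fderiv ℝ (fun u => F u s) c) c :=
    (((H.contDiffOn_F s).differentiableOn one_ne_zero).differentiableAt
      (H.isOpen.mem_nhds hc)).hasFDerivAt
  rw [linF, inner_gradient_eq_fderiv]
  exact (H.convexOn s).add_fderiv_sub_le hd hc hx

theorem inner_linG_le {s : Ξ} {c x : E} (hc : c ∈ O) (hx : x ∈ O) {v : V}
    (hv : v ∈ polarCone K) : inner ℝ v (linG G s c x) ≤ inner ℝ v (G x s) := by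
  have hd : HasFDerivAt (fun u => G u s) (fderiv ℝ (fun u => G u s) c) c :=
    (((H.contDiffOn_G s).differentiableOn one_ne_zero).differentiableAt
      (H.isOpen.mem_nhds hc)).hasFDerivAt
  have hd' : HasFDerivAt (fun u => inner ℝ v (G u s))
      ((innerSL ℝ v).comp (fderiv ℝ (fun u => G u s) c)) c :=
    (innerSL ℝ v).hasFDerivAt.comp c hd
  have := ((H.graphConvexOn s).convexOn_inner H.convex_domain hv).add_fderiv_sub_le hd' hc hx
  rw [linG, inner_add_right]
  simpa using this

end IsBoundedConvexSample

variable [FiniteDimensional ℝ V] {σ : ℝ} {s : Ξ} {c p : E} {y : V}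

omit H in
theorem convexOn_linF_add_augPenalty (hX : Convex ℝ X) (hσ : 0 < σ) (s : Ξ) (c : E) (y : V) :
    ConvexOn ℝ X (fun u => linF F s c u + augPenalty K σ y (linG G s c u)) := by
  refine ⟨hX, fun u _ w _ a b ha hb hab => ?_⟩
  have h := (convexOn_augPenalty (K := K) hσ y).2 (Set.mem_univ (linG G s c u))
    (Set.mem_univ (linG G s c w)) ha hb hab
  simp only [linF_combo F s c u w hab, linG_combo G s c u w hab]
  simp only [smul_eq_mul] at h ⊢
  linarith

omit H in
/-- Quadratic growth at the minimizer of the linearized subproblem. -/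
theorem subproblem_growth (hX : Convex ℝ X) (hσ : 0 < σ) (hp : p ∈ X)
    (hmin : IsMinOn (fun u => augLagrangian K σ (linF F s c) (linG G s c) u y
      + 1 / (2 * σ) * ‖u - c‖ ^ 2) X p) {u : E} (hu : u ∈ X) :
    linF F s c p + augPenalty K σ y (linG G s c p) + 1 / (2 * σ) * ‖p - c‖ ^ 2
      + 1 / (2 * σ) * ‖u - p‖ ^ 2
      ≤ linF F s c u + augPenalty K σ y (linG G s c u) + 1 / (2 * σ) * ‖u - c‖ ^ 2 :=
  IsMinOn.add_sq_le_of_convexOn (convexOn_linF_add_augPenalty hX hσ s c y) hp hmin hu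

namespace IsBoundedConvexSample

theorem augPenalty_linG_le (hσ : 0 < σ) (hc : c ∈ X) {u : E} (hu : u ∈ X) :
    augPenalty K σ y (linG G s c u) ≤ inner ℝ y (G u s) + σ / 2 * νg ^ 2 := by
  refine (augPenalty_mono hσ y fun v hv => H.inner_linG_le (H.subset hc) (H.subset hu) hv).trans
    ((augPenalty_le hσ y _).trans ?_)
  have := H.norm_G_le s u (H.subset hu)
  gcongr

/-- The Lyapunov recursion behind the multiplier bound: at the Slater point the last term has
negative mean proportional to `‖y‖`. -/
theorem sq_add_sq_step_le (hσ : 0 < σ) (hc : c ∈ X) (hp : p ∈ X)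
    (hmin : IsMinOn (fun u => augLagrangian K σ (linF F s c) (linG G s c) u y
      + 1 / (2 * σ) * ‖u - c‖ ^ 2) X p) {u : E} (hu : u ∈ X) :
    ‖metricProj (polarCone K) (y + σ • linG G s c p)‖ ^ 2 + ‖u - p‖ ^ 2
      ≤ ‖y‖ ^ 2 + ‖u - c‖ ^ 2
        + 2 * σ * (κf * R + σ / 2 * νg ^ 2 + inner ℝ y (G u s)) := by
  have h1 := subproblem_growth H.convex hσ hp hmin hu
  have h2 := H.augPenalty_linG_le (y := y) (s := s) hσ hc hu
  have h3 : linF F s c u - linF F s c p ≤ κf * R := by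
    rw [linF_sub]
    have hk := H.norm_gradient_le s c (H.subset hc)
    exact (real_inner_le_norm _ _).trans (mul_le_mul hk (H.diam_le u hu p hp)
      (norm_nonneg _) ((norm_nonneg _).trans hk))
  rw [augPenalty] at h1
  have h4 : 0 ≤ 1 / (2 * σ) * ‖p - c‖ ^ 2 := by positivity
  set q := metricProj (polarCone K) (y + σ • linG G s c p)
  have h5 : 1 / (2 * σ) * ((‖q‖ ^ 2 + ‖u - p‖ ^ 2) - (‖y‖ ^ 2 + ‖u - c‖ ^ 2))
      ≤ κf * R + σ / 2 * νg ^ 2 + inner ℝ y (G u s) := by linarith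
  rw [one_div, inv_mul_le_iff₀ (by positivity)] at h5
  linarith

/-- Comparing with `u = c` produces the proximal square twice. The objective can fall only linearly
in `‖p - c‖`: the penalty is bounded below at `p` by testing with the dual maximiser at `c`, of norm
at most `‖y‖ + σ νg`. -/
theorem norm_step_le (hσ : 0 < σ) (hc : c ∈ X) (hp : p ∈ X)
    (hmin : IsMinOn (fun u => augLagrangian K σ (linF F s c) (linG G s c) u y
      + 1 / (2 * σ) * ‖u - c‖ ^ 2) X p) :
    ‖p - c‖ ≤ σ * (κf + κg * (‖y‖ + σ * νg)) := by
  have h1 := subproblem_growth H.convex hσ hp hmin hc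
  have hq := metricProj_mem K (y + σ • G c s)
  have hqn : ‖metricProj (polarCone K) (y + σ • G c s)‖ ≤ ‖y‖ + σ * νg := by
    refine (norm_metricProj_le K _).trans ((norm_add_le _ _).trans ?_)
    rw [norm_smul, Real.norm_of_nonneg hσ.le]
    have := H.norm_G_le s c (H.subset hc)
    gcongr
  have h2 := augPenalty_eq (K := K) hσ y (G c s)
  have h3 := le_augPenalty hσ y (linG G s c p) hq
  rw [linG_self] at h1
  set q := metricProj (polarCone K) (y + σ • G c s)
  have h4 : 0 ≤ 1 / (2 * σ) * ‖q - metricProj (polarCone K) (y + σ • linG G s c p)‖ ^ 2 := by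
    positivity
  have h5 : linF F s c c - linF F s c p ≤ κf * ‖p - c‖ := by
    rw [linF_sub, ← norm_sub_rev]
    exact (real_inner_le_norm _ _).trans
      (mul_le_mul_of_nonneg_right (H.norm_gradient_le s c (H.subset hc)) (norm_nonneg _))
  have h6 : inner ℝ q (G c s) - inner ℝ q (linG G s c p) ≤ (‖y‖ + σ * νg) * (κg * ‖p - c‖) := by
    have e : inner ℝ q (G c s) - inner ℝ q (linG G s c p)
        = - inner ℝ q (fderiv ℝ (fun u => G u s) c (p - c)) := by
      rw [linG, inner_add_right]; ring
    rw [e]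
    refine (neg_le_abs _).trans ((abs_real_inner_le_norm _ _).trans ?_)
    have hb : ‖fderiv ℝ (fun u => G u s) c (p - c)‖ ≤ κg * ‖p - c‖ :=
      (ContinuousLinearMap.le_opNorm _ _).trans
        (mul_le_mul_of_nonneg_right (H.norm_fderiv_le s c (H.subset hc)) (norm_nonneg _))
    exact mul_le_mul hqn hb (norm_nonneg _) ((norm_nonneg _).trans hqn)
  rw [norm_sub_rev c p, sub_self, norm_zero] at h1
  have h7 : 1 / σ * ‖p - c‖ ^ 2 ≤ (κf + κg * (‖y‖ + σ * νg)) * ‖p - c‖ := by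
    have : 1 / σ * ‖p - c‖ ^ 2
      = 1 / (2 * σ) * ‖p - c‖ ^ 2 + 1 / (2 * σ) * ‖p - c‖ ^ 2 := by field_simp; ring
    linarith
  rw [one_div, inv_mul_le_iff₀ hσ] at h7
  rcases (norm_nonneg (p - c)).eq_or_lt with h0 | h0
  · rw [← h0]
    have hκf := (norm_nonneg _).trans (H.norm_gradient_le s c (H.subset hc))
    have hκg := (norm_nonneg _).trans (H.norm_fderiv_le s c (H.subset hc))
    have hn := (norm_nonneg _).trans hqn
    positivity
  · exact le_of_mul_le_mul_right (by linarith) h0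

/-- Growth at the primal minimizer supplies `‖u - p‖²`, and testing the dual form with `v` supplies
the multiplier square. -/
theorem saddle_step_le (hσ : 0 < σ) (hc : c ∈ X) (hp : p ∈ X)
    (hmin : IsMinOn (fun u => augLagrangian K σ (linF F s c) (linG G s c) u y
      + 1 / (2 * σ) * ‖u - c‖ ^ 2) X p) {u : E} (hu : u ∈ X) {v : V} (hv : v ∈ polarCone K) :
    F c s + inner ℝ v (G c s) - ‖v‖ * (κg * ‖p - c‖)
      + 1 / (2 * σ) * (‖v - metricProj (polarCone K) (y + σ • linG G s c p)‖ ^ 2 + ‖u - p‖ ^ 2)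
      ≤ F u s + inner ℝ y (G u s) + σ / 2 * (νg ^ 2 + κf ^ 2)
        + 1 / (2 * σ) * (‖v - y‖ ^ 2 + ‖u - c‖ ^ 2) := by
  have h1 := subproblem_growth H.convex hσ hp hmin hu
  have h2 := H.augPenalty_linG_le (y := y) (s := s) hσ hc hu
  have h3 := le_augPenalty hσ y (linG G s c p) hv
  have h4 := H.linF_le (s := s) (H.subset hc) (H.subset hu)
  have h5 : F c s - linF F s c p ≤ κf * ‖p - c‖ := by
    rw [← linF_self F s c, linF_sub, ← norm_sub_rev]
    exact (real_inner_le_norm _ _).trans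
      (mul_le_mul_of_nonneg_right (H.norm_gradient_le s c (H.subset hc)) (norm_nonneg _))
  have h6 : inner ℝ v (G c s) - ‖v‖ * (κg * ‖p - c‖) ≤ inner ℝ v (linG G s c p) := by
    rw [linG, inner_add_right, sub_eq_add_neg]
    gcongr
    rw [neg_le]
    refine (neg_le_abs _).trans ((abs_real_inner_le_norm _ _).trans ?_)
    gcongr
    exact (ContinuousLinearMap.le_opNorm _ _).trans
        (mul_le_mul_of_nonneg_right (H.norm_fderiv_le s c (H.subset hc)) (norm_nonneg _))
  -- Young's inequality spends the whole proximal square on the objective's linearization error; the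
  -- constraint's error, of size `‖v‖ κg ‖p - c‖`, stays and is left to `norm_step_le`.
  have h7 : κf * ‖p - c‖ ≤ σ / 2 * κf ^ 2 + 1 / (2 * σ) * ‖p - c‖ ^ 2 := by
    rw [← sub_nonneg]
    have : σ / 2 * κf ^ 2 + 1 / (2 * σ) * ‖p - c‖ ^ 2 - κf * ‖p - c‖
      = 1 / (2 * σ) * (σ * κf - ‖p - c‖) ^ 2 := by field_simp; ring
    rw [this]; positivity
  linarith

end IsBoundedConvexSample

variable {x₁ : E} {ξ : ℕ → Ξ} {x : ℕ → E} {y : ℕ → V}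

omit H [FiniteDimensional ℝ V] in
theorem IsLSAALRun.x_mem' (hrun : IsLSAALRun F G X K σ x₁ ξ x y) (hx₁ : x₁ ∈ X) (k : ℕ) :
    x k ∈ X := by
  cases k with
  | zero => rw [hrun.x_init]; exact hx₁
  | succ k => exact hrun.x_mem k

omit H in
theorem IsLSAALRun.y_mem (hrun : IsLSAALRun F G X K σ x₁ ξ x y) (k : ℕ) :
    y k ∈ polarCone K := by
  cases k with
  | zero => rw [hrun.y_init]; exact zero_mem_polarCone
  | succ k => rw [hrun.y_step]; exact metricProj_mem K _

theorem IsLSAALRun.sum_saddle_le (hrun : IsLSAALRun F G X K σ x₁ ξ x y) (hσ : 0 < σ)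
    (hx₁ : x₁ ∈ X) {u : E} (hu : u ∈ X) {v : V} (hv : v ∈ polarCone K) (N : ℕ) :
    ∑ k ∈ Finset.range N, (F (x k) (ξ k) - F u (ξ k) + inner ℝ v (G (x k) (ξ k))
        - inner ℝ (y k) (G u (ξ k)))
      ≤ N * (σ / 2 * (νg ^ 2 + κf ^ 2))
        + ‖v‖ * κg * ∑ k ∈ Finset.range N, (σ * (κf + κg * (‖y k‖ + σ * νg)))
        + 1 / (2 * σ) * (‖v‖ ^ 2 + R ^ 2) := by
  have hκg := (norm_nonneg _).trans (H.norm_fderiv_le (ξ 0) u (H.subset hu))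
  have key : ∀ N : ℕ, ∑ k ∈ Finset.range N, (F (x k) (ξ k) - F u (ξ k)
        + inner ℝ v (G (x k) (ξ k)) - inner ℝ (y k) (G u (ξ k)))
        + 1 / (2 * σ) * (‖v - y N‖ ^ 2 + ‖u - x N‖ ^ 2)
      ≤ N * (σ / 2 * (νg ^ 2 + κf ^ 2))
        + ‖v‖ * κg * ∑ k ∈ Finset.range N, (σ * (κf + κg * (‖y k‖ + σ * νg)))
        + 1 / (2 * σ) * (‖v‖ ^ 2 + R ^ 2) := by
    intro N
    induction N with
    | zero =>
      have := H.diam_le u hu x₁ hx₁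
      simp only [Finset.range_zero, Finset.sum_empty, hrun.y_init, hrun.x_init, sub_zero,
        Nat.cast_zero, zero_mul, mul_zero, zero_add]
      gcongr
    | succ k ih =>
      have hk := hrun.x_mem' hx₁ k
      have h1 := H.saddle_step_le hσ hk (hrun.x_mem k) (hrun.x_step k) hu hv
      have h2 := H.norm_step_le hσ hk (hrun.x_mem k) (hrun.x_step k)
      rw [← hrun.y_step] at h1
      have h3 := mul_le_mul_of_nonneg_left h2 (mul_nonneg (norm_nonneg v) hκg)
      rw [Finset.sum_range_succ, Finset.sum_range_succ]
      push_cast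
      linarith
  refine le_trans (le_add_of_nonneg_right ?_) (key N)
  positivity

end Run

/-! ### Measurable selection of minimizers. -/

section Argmin

/-- A minimizer with quadratic growth of a Carathéodory function is measurable. -/
theorem measurable_of_quadratic_growth {α E : Type*} [MeasurableSpace α] [NormedAddCommGroup E]
    [SecondCountableTopology E] [MeasurableSpace E] [BorelSpace E] {X : Set E}
    {h : E → α → ℝ} {T : α → E} {c : ℝ} (hc : 0 < c) (hT : ∀ a, T a ∈ X)
    (hm : ∀ u ∈ X, Measurable (h u)) (hcont : ∀ a, ContinuousOn (fun u => h u a) X)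
    (hg : ∀ a, ∀ u ∈ X, h (T a) a + c * ‖u - T a‖ ^ 2 ≤ h u a) : Measurable T := by
  classical
  rcases isEmpty_or_nonempty α with hα | ⟨⟨a₀⟩⟩
  · exact measurable_of_empty T
  have : Nonempty X := ⟨⟨T a₀, hT a₀⟩⟩
  let d : ℕ → X := TopologicalSpace.denseSeq X
  have hd : DenseRange d := TopologicalSpace.denseRange_denseSeq X
  have hap : ∀ a, ∀ ε > 0, ∃ j, h (d j) a < h (T a) a + ε := by
    intro a ε hε
    have hopen : IsOpen {u : X | h u a < h (T a) a + ε} :=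
      isOpen_lt (continuousOn_iff_continuous_domRestrict.1 (hcont a)) continuous_const
    obtain ⟨j, hj⟩ := hd.exists_mem_open hopen ⟨⟨T a, hT a⟩, by simpa using hε⟩
    exact ⟨j, hj⟩
  have hmin : ∀ a j, h (T a) a ≤ h (d j) a := fun a j =>
    le_trans (le_add_of_nonneg_right (by positivity)) (hg a (d j) (d j).2)
  -- Near-optimality is tested against the dense points only, since measurability of the optimal
  -- value is not yet available. The first such index is measurable, and quadratic growth forces
  -- these near-minimizers to converge to `T a`.
  have hex : ∀ (m : ℕ) (a : α), ∃ n, ∀ j, h (d n) a ≤ h (d j) a + 1 / ((m : ℝ) + 1) := by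
    intro m a
    obtain ⟨n, hn⟩ := hap a (1 / ((m : ℝ) + 1)) (by positivity)
    exact ⟨n, fun j => hn.le.trans (by linarith [hmin a j])⟩
  let A : ℕ → α → E := fun m a => d (Nat.find (hex m a))
  have hA : ∀ m, Measurable (A m) := by
    intro m
    refine (measurable_from_nat (f := fun n => (d n : E))).comp (measurable_find (hex m) fun n => ?_)
    simp only [Set.ofPred_forall]
    exact MeasurableSet.iInter fun j =>
      measurableSet_le (hm _ (d n).2) ((hm _ (d j).2).add_const _)
  refine measurable_of_tendsto_metrizable hA (tendsto_pi_nhds.2 fun a => ?_)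
  have hbound : ∀ m : ℕ, c * ‖A m a - T a‖ ^ 2 ≤ 1 / ((m : ℝ) + 1) := by
    intro m
    have h1 := hg a (A m a) (d _).2
    have h2 : h (A m a) a ≤ h (T a) a + 1 / ((m : ℝ) + 1) := by
      refine le_of_forall_pos_le_add fun ε hε => ?_
      obtain ⟨j, hj⟩ := hap a ε hε
      have := Nat.find_spec (hex m a) j
      change h (A m a) a ≤ _ at this
      linarith
    linarith
  rw [tendsto_iff_norm_sub_tendsto_zero]
  have h0 : Filter.Tendsto (fun m : ℕ => ‖A m a - T a‖ ^ 2) Filter.atTop (nhds 0) := by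
    have hl := (tendsto_one_div_add_atTop_nhds_zero_nat (𝕜 := ℝ)).const_mul c⁻¹
    rw [mul_zero] at hl
    refine squeeze_zero (fun m => by positivity) (fun m => ?_) hl
    rw [le_inv_mul_iff₀ hc]
    exact hbound m
  have := h0.sqrt
  simpa [Real.sqrt_sq (norm_nonneg _)] using this

end Argmin

/-! ### Joint measurability of the linearizations. -/

section Linearization

variable {E W Ξ : Type*} [NormedAddCommGroup E] [NormedAddCommGroup W] [NormedSpace ℝ W]
  [MeasurableSpace Ξ] [MeasurableSpace W] [BorelSpace W] [SecondCountableTopology W]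

/-- A directional derivative is a pointwise limit of difference quotients; the index shift `n₀`
keeps their base points in `O`. -/
theorem measurable_fderiv_param [NormedSpace ℝ E] {H : E → Ξ → W} {O : Set E} (hO : IsOpen O)
    (hm : ∀ x ∈ O, Measurable (H x)) {c : E} (hc : c ∈ O)
    (hd : ∀ s, DifferentiableAt ℝ (fun u => H u s) c) (v : E) :
    Measurable fun s => fderiv ℝ (fun u => H u s) c v := by
  have hmem : ∀ᶠ n : ℕ in Filter.atTop, c + ((n : ℝ))⁻¹ • v ∈ O := by
    have : Filter.Tendsto (fun n : ℕ => c + ((n : ℝ))⁻¹ • v) Filter.atTop (nhds (c + (0 : ℝ) • v)) :=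
      tendsto_const_nhds.add (tendsto_inv_atTop_nhds_zero_nat.smul_const v)
    rw [zero_smul, add_zero] at this
    exact this.eventually (hO.mem_nhds hc)
  obtain ⟨n₀, hn₀⟩ := Filter.eventually_atTop.1 hmem
  refine measurable_of_tendsto_metrizable
    (f := fun (n : ℕ) s => ((n + n₀ : ℕ) : ℝ) • (H (c + (((n + n₀ : ℕ) : ℝ))⁻¹ • v) s - H c s))
    (fun n => ((hm _ (hn₀ _ (by omega))).sub (hm c hc)).const_smul _)
    (tendsto_pi_nhds.2 fun s => ?_)
  have hlim := (hd s).hasFDerivAt.lim v (c := fun n : ℕ => (n : ℝ)) (l := Filter.atTop)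
    (by simpa using tendsto_natCast_atTop_atTop (R := ℝ))
  exact hlim.comp (Filter.tendsto_add_atTop_nat n₀)

theorem measurable_linG [InnerProductSpace ℝ E] [SecondCountableTopology E] [MeasurableSpace E]
    [BorelSpace E] {H : E → Ξ → W} {X O : Set E} (hO : IsOpen O) (hXO : X ⊆ O)
    (hm : ∀ x ∈ O, Measurable (H x)) (hs : ∀ s, ContDiffOn ℝ 1 (fun x => H x s) O) :
    Measurable fun q : (X × E) × Ξ => H q.1.1 q.2
      + fderiv ℝ (fun u => H u q.2) q.1.1 (q.1.2 - q.1.1) := by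
  refine measurable_uncurry_of_continuous_of_measurable
    (u := fun (p : X × E) s => H p.1 s + fderiv ℝ (fun u => H u s) p.1 (p.2 - p.1))
    (fun s => ?_) (fun p => ?_)
  · have h1 : Continuous fun c : X => H c s :=
      continuousOn_iff_continuous_domRestrict.1 ((hs s).continuousOn.mono hXO)
    have h2 : Continuous fun c : X => fderiv ℝ (fun u => H u s) (c : E) :=
      continuousOn_iff_continuous_domRestrict.1
        (((hs s).continuousOn_fderiv_of_isOpen hO le_rfl).mono hXO)
    exact (h1.comp continuous_fst).add ((h2.comp continuous_fst).clm_apply (by fun_prop))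
  · exact (hm _ (hXO p.1.2)).add (measurable_fderiv_param hO hm (hXO p.1.2)
      (fun s => ((hs s).differentiableOn one_ne_zero).differentiableAt
        (hO.mem_nhds (hXO p.1.2))) _)

end Linearization

/-! ### Filtration of the samples and exponential moments. -/

section Past

variable {Ω Ξ : Type*} [MeasurableSpace Ξ]

/-- The σ-algebra generated by the first `k` samples. -/
@[reducible]
def pastAlgebra (ξ : ℕ → Ω → Ξ) (k : ℕ) : MeasurableSpace Ω :=
  ⨆ i ∈ Set.Iio k, MeasurableSpace.comap (ξ i) inferInstance

theorem pastAlgebra_mono (ξ : ℕ → Ω → Ξ) {j k : ℕ} (h : j ≤ k) :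
    pastAlgebra ξ j ≤ pastAlgebra ξ k :=
  biSup_mono fun _ hi => lt_of_lt_of_le hi h

theorem measurable_pastAlgebra (ξ : ℕ → Ω → Ξ) (k : ℕ) :
    Measurable[pastAlgebra ξ (k + 1)] (ξ k) := by
  rw [measurable_iff_comap_le]
  exact le_biSup (fun i => MeasurableSpace.comap (ξ i) inferInstance) (Nat.lt_succ_self k)

variable {mΩ : MeasurableSpace Ω} {μ : Measure Ω} {P : Measure Ξ} {ξ : ℕ → Ω → Ξ}

theorem pastAlgebra_le (hξm : ∀ k, Measurable (ξ k)) (k : ℕ) : pastAlgebra ξ k ≤ mΩ :=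
  iSup₂_le fun i _ => (hξm i).comap_le

theorem indep_pastAlgebra (hξm : ∀ k, Measurable (ξ k)) (hind : iIndepFun ξ μ) (k : ℕ) :
    Indep (pastAlgebra ξ k) (MeasurableSpace.comap (ξ k) inferInstance) μ := by
  have h := indep_iSup_of_disjoint (fun i => (hξm i).comap_le) hind
    (S := Set.Iio k) (T := {k}) (by simp)
  simpa [pastAlgebra] using h

/-- Freezing lemma: a sample may be integrated out against a state known before it is drawn. -/
theorem lintegral_past_eq [IsProbabilityMeasure μ] [IsProbabilityMeasure P]
    (hξm : ∀ k, Measurable (ξ k)) (hξ : ∀ k, HasLaw (ξ k) P μ) (hind : iIndepFun ξ μ)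
    {S : Type*} [MeasurableSpace S] {k : ℕ} {W : Ω → S} (hW : Measurable[pastAlgebra ξ k] W)
    {h : S × Ξ → ENNReal} (hh : Measurable h) :
    ∫⁻ ω, h (W ω, ξ k ω) ∂μ = ∫⁻ ω, ∫⁻ s, h (W ω, s) ∂P ∂μ := by
  have hW' : Measurable W := hW.mono (pastAlgebra_le hξm k) le_rfl
  have hi : IndepFun W (ξ k) μ := by
    rw [IndepFun_iff_Indep]
    exact indep_of_indep_of_le_left (indep_pastAlgebra hξm hind k) hW.comap_le
  have hmap := hi.map_prod_eq_prod_map_map hW'.aemeasurable (hξm k).aemeasurable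
  rw [(hξ k).map_eq] at hmap
  have : IsProbabilityMeasure (μ.map W) := Measure.isProbabilityMeasure_map hW'.aemeasurable
  calc ∫⁻ ω, h (W ω, ξ k ω) ∂μ = ∫⁻ z, h z ∂(μ.map fun ω => (W ω, ξ k ω)) :=
        (lintegral_map hh (hW'.prodMk (hξm k))).symm
    _ = ∫⁻ w, ∫⁻ s, h (w, s) ∂P ∂(μ.map W) := by
        rw [hmap, lintegral_prod _ hh.aemeasurable]
    _ = _ := lintegral_map hh.lintegral_prod_right' hW'

theorem measurable_sum_past {S : Type*} [MeasurableSpace S] {W : ℕ → Ω → S}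
    (hW : ∀ k, Measurable[pastAlgebra ξ k] (W k)) {ψ : S × Ξ → ℝ} (hψ : Measurable ψ) (n : ℕ) :
    Measurable[pastAlgebra ξ n] fun ω => ∑ k ∈ Finset.range n, ψ (W k ω, ξ k ω) := by
  refine @Finset.measurable_sum _ _ _ _ _ _ (pastAlgebra ξ n) _ _ fun k hk => ?_
  have hk' : k + 1 ≤ n := Finset.mem_range.1 hk
  have h1 : Measurable[pastAlgebra ξ n] (W k) :=
    (hW k).mono (pastAlgebra_mono ξ (by omega)) le_rfl
  have h2 : Measurable[pastAlgebra ξ n] (ξ k) :=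
    (measurable_pastAlgebra ξ k).mono (pastAlgebra_mono ξ hk') le_rfl
  exact hψ.comp (h1.prodMk h2)

/-- Peeling off the last sample with the freezing lemma multiplies the moment by at most `exp a`.
Lower integrals avoid any prior integrability claim. -/
theorem lintegral_exp_sum_le [IsProbabilityMeasure μ] [IsProbabilityMeasure P]
    (hξm : ∀ k, Measurable (ξ k)) (hξ : ∀ k, HasLaw (ξ k) P μ) (hind : iIndepFun ξ μ)
    {S : Type*} [MeasurableSpace S] {W : ℕ → Ω → S}
    (hW : ∀ k, Measurable[pastAlgebra ξ k] (W k)) {ψ : S × Ξ → ℝ} (hψ : Measurable ψ) {a : ℝ}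
    (hmgf : ∀ w, ∫⁻ s, ENNReal.ofReal (Real.exp (ψ (w, s))) ∂P ≤ ENNReal.ofReal (Real.exp a))
    (n : ℕ) :
    ∫⁻ ω, ENNReal.ofReal (Real.exp (∑ k ∈ Finset.range n, ψ (W k ω, ξ k ω))) ∂μ
      ≤ ENNReal.ofReal (Real.exp (n * a)) := by
  induction n with
  | zero => simp
  | succ n ih =>
    have hS := measurable_sum_past hW hψ n
    have hpair := hS.prodMk (hW n)
    have hh : Measurable fun q : (ℝ × S) × Ξ =>
        ENNReal.ofReal (Real.exp q.1.1) * ENNReal.ofReal (Real.exp (ψ (q.1.2, q.2))) := by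
      fun_prop
    have key := lintegral_past_eq hξm hξ hind hpair hh
    have hsplit : ∀ u v : ℝ, ENNReal.ofReal (Real.exp (u + v))
        = ENNReal.ofReal (Real.exp u) * ENNReal.ofReal (Real.exp v) := fun u v => by
      rw [Real.exp_add, ENNReal.ofReal_mul (Real.exp_pos u).le]
    simp only [Finset.sum_range_succ, hsplit]
    rw [key]
    calc _ ≤ ∫⁻ ω, ENNReal.ofReal (Real.exp (∑ k ∈ Finset.range n, ψ (W k ω, ξ k ω)))
            * ENNReal.ofReal (Real.exp a) ∂μ := by
          refine lintegral_mono fun ω => ?_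
          dsimp only
          rw [lintegral_const_mul _ (by fun_prop)]
          exact mul_le_mul_right (hmgf _) _
      _ ≤ ENNReal.ofReal (Real.exp (n * a)) * ENNReal.ofReal (Real.exp a) := by
          rw [lintegral_mul_const']
          · exact mul_le_mul_left ih _
          · exact ENNReal.ofReal_ne_top
      _ = _ := by rw [← hsplit]; push_cast; ring_nf

/-- Markov's inequality for the exponential. -/
theorem measure_ge_le_lintegral_exp_mul {f : Ω → ℝ} (hf : Measurable f) (t : ℝ) :
    μ {ω | t ≤ f ω}
      ≤ (∫⁻ ω, ENNReal.ofReal (Real.exp (f ω)) ∂μ) * ENNReal.ofReal (Real.exp (-t)) := by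
  have h1 := mul_meas_ge_le_lintegral (μ := μ)
    (f := fun ω => ENNReal.ofReal (Real.exp (f ω))) (by fun_prop) (ENNReal.ofReal (Real.exp t))
  have h2 : {ω | ENNReal.ofReal (Real.exp t) ≤ ENNReal.ofReal (Real.exp (f ω))}
      = {ω | t ≤ f ω} := by
    ext ω
    simp [ENNReal.ofReal_le_ofReal_iff (Real.exp_pos _).le]
  rw [h2] at h1
  have hpos : ENNReal.ofReal (Real.exp t) ≠ 0 := by simp [Real.exp_pos]
  rw [Real.exp_neg, ENNReal.ofReal_inv_of_pos (Real.exp_pos t), ← div_eq_mul_inv,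
    ENNReal.le_div_iff_mul_le (Or.inl hpos) (Or.inl ENNReal.ofReal_ne_top), mul_comm]
  exact h1

end Past

/-! ### Light-tailed variables and their concentration. -/

section LightTail

/-- The linear term is kept apart because it integrates to zero for centred variables. -/
theorem exp_le_add_exp_sq (u : ℝ) : Real.exp u ≤ u + Real.exp (u ^ 2) := by
  have h2 := Real.add_one_le_exp (u ^ 2)
  rcases le_or_gt 1 u with h | h
  · have : Real.exp u ≤ Real.exp (u ^ 2) := Real.exp_le_exp.2 (by nlinarith)
    linarith
  rcases le_or_gt u (-1) with h' | h'
  · have : Real.exp u ≤ 1 := Real.exp_le_one_iff.2 (by linarith)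
    nlinarith
  · have := abs_le.1 (Real.abs_exp_sub_one_sub_id_le (x := u) (abs_le.2 ⟨h'.le, h.le⟩))
    linarith [this.2]

variable {Ξ : Type*} [MeasurableSpace Ξ] {P : Measure Ξ}

/-- The light-tail condition `𝔼[exp (ζ² / ν²)] ≤ e`. -/
def IsLightTailed (ζ : Ξ → ℝ) (ν : ℝ) (P : Measure Ξ) : Prop :=
  Integrable (fun s => Real.exp (ζ s ^ 2 / ν ^ 2)) P ∧
    ∫ s, Real.exp (ζ s ^ 2 / ν ^ 2) ∂P ≤ Real.exp 1

theorem IsLightTailed.of_le {ζ a b : Ξ → ℝ} {ν α β : ℝ} (hζ : Measurable ζ)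
    (ha : Integrable a P) (hb : Integrable b P) (hα : 0 ≤ α) (hβ : 0 ≤ β) (hαβ : α + β = 1)
    (hae : ∫ s, a s ∂P ≤ Real.exp 1) (hbe : ∫ s, b s ∂P ≤ Real.exp 1)
    (h : ∀ s, Real.exp (ζ s ^ 2 / ν ^ 2) ≤ α * a s + β * b s) : IsLightTailed ζ ν P := by
  have hint : Integrable (fun s => α * a s + β * b s) P := (ha.const_mul α).add (hb.const_mul β)
  have hi : Integrable (fun s => Real.exp (ζ s ^ 2 / ν ^ 2)) P := by
    refine hint.mono' (by fun_prop) (Filter.Eventually.of_forall fun s => ?_)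
    rw [Real.norm_of_nonneg (Real.exp_pos _).le]
    exact h s
  refine ⟨hi, (integral_mono hi hint h).trans ?_⟩
  rw [integral_add (ha.const_mul α) (hb.const_mul β), integral_const_mul, integral_const_mul]
  calc α * ∫ s, a s ∂P + β * ∫ s, b s ∂P ≤ α * Real.exp 1 + β * Real.exp 1 := by gcongr
    _ = Real.exp 1 := by rw [← add_mul, hαβ, one_mul]

theorem exp_convex_combo {α β u v : ℝ} (hα : 0 ≤ α) (hβ : 0 ≤ β) (hαβ : α + β = 1) :
    Real.exp (α * u + β * v) ≤ α * Real.exp u + β * Real.exp v := by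
  simpa using convexOn_exp.2 (Set.mem_univ u) (Set.mem_univ v) hα hβ hαβ

theorem IsLightTailed.sub {a b : Ξ → ℝ} {ν : ℝ} (hν : 0 < ν) (ha : IsLightTailed a ν P)
    (hb : IsLightTailed b ν P) (ham : Measurable a) (hbm : Measurable b) :
    IsLightTailed (fun s => a s - b s) (2 * ν) P := by
  refine IsLightTailed.of_le (α := 1 / 2) (β := 1 / 2) (ham.sub hbm) ha.1 hb.1 (by norm_num)
    (by norm_num) (by norm_num) ha.2 hb.2 fun s => ?_
  refine le_trans (Real.exp_le_exp.2 ?_)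
    (exp_convex_combo (by norm_num) (by norm_num) (by norm_num))
  rw [div_le_iff₀ (by positivity)]
  have : (1 / 2 * (a s ^ 2 / ν ^ 2) + 1 / 2 * (b s ^ 2 / ν ^ 2)) * (2 * ν) ^ 2
    = 2 * a s ^ 2 + 2 * b s ^ 2 := by field_simp
  rw [this]
  nlinarith [sq_nonneg (a s + b s)]

/-- Scales add as for a norm: `((a + b)/(ν + c))²` is at most the average of `(a/ν)²` and `1` with
weights `ν/(ν + c)` and `c/(ν + c)`, and `exp` is convex. -/
theorem IsLightTailed.add_bounded [IsProbabilityMeasure P] {a b : Ξ → ℝ} {ν c : ℝ} (hν : 0 < ν)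
    (hc : 0 ≤ c) (ha : IsLightTailed a ν P) (ham : Measurable a) (hbm : Measurable b)
    (hb : ∀ s, |b s| ≤ c) : IsLightTailed (fun s => a s + b s) (ν + c) P := by
  have hνc : 0 < ν + c := by linarith
  have h1 : ν / (ν + c) + c / (ν + c) = 1 := by field_simp
  refine IsLightTailed.of_le (α := ν / (ν + c)) (β := c / (ν + c)) (b := fun _ => Real.exp 1)
    (ham.add hbm) ha.1 (integrable_const _) (by positivity) (by positivity) h1 ha.2 (by simp)
    fun s => ?_
  refine le_trans (Real.exp_le_exp.2 ?_) (exp_convex_combo (by positivity) (by positivity) h1)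
  rw [div_le_iff₀ (by positivity)]
  have e : (ν / (ν + c) * (a s ^ 2 / ν ^ 2) + c / (ν + c) * 1) * (ν + c) ^ 2
    = a s ^ 2 + c * (a s ^ 2 / ν + ν) + c ^ 2 := by field_simp; ring
  rw [e]
  have h2 : 2 * |a s| ≤ a s ^ 2 / ν + ν := by
    rw [← sub_nonneg]
    have : a s ^ 2 / ν + ν - 2 * |a s| = 1 / ν * (|a s| - ν) ^ 2 := by
      rw [← sq_abs (a s)]; field_simp; ring
    rw [this]; positivity
  have h3 : (a s + b s) ^ 2 ≤ (|a s| + c) ^ 2 := by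
    rw [← sq_abs (a s + b s)]
    have := (abs_add_le (a s) (b s)).trans (by linarith [hb s] : _ ≤ |a s| + c)
    gcongr
  have := sq_abs (a s)
  nlinarith [mul_le_mul_of_nonneg_left h2 hc]

/-- Convexity bounds `exp (ζ²/(N ν²))` by `1 - 1/N + exp (ζ²/ν²)/N`, of mean at most `1 + 2/N` since
`e < 3`. Over `N` steps the moment stays below `e²`. -/
theorem IsLightTailed.lintegral_exp_le [IsProbabilityMeasure P] {ζ : Ξ → ℝ} {ν : ℝ} (hν : 0 < ν)
    (hζ : IsLightTailed ζ ν P) (hi : Integrable ζ P) (h0 : ∫ s, ζ s ∂P = 0) {N : ℕ} (hN : 0 < N) :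
    ∫⁻ s, ENNReal.ofReal (Real.exp (1 / (ν * √N) * ζ s)) ∂P
      ≤ ENNReal.ofReal (Real.exp (2 / N)) := by
  have hN' : (1 : ℝ) ≤ N := by exact_mod_cast hN
  have hN1 : 1 / (N : ℝ) ≤ 1 := by rw [div_le_one (by linarith)]; exact hN'
  have hpt : ∀ s, Real.exp (1 / (ν * √N) * ζ s)
      ≤ 1 / (ν * √N) * ζ s + ((1 - 1 / N) + 1 / N * Real.exp (ζ s ^ 2 / ν ^ 2)) := by
    intro s
    refine (exp_le_add_exp_sq _).trans ?_
    gcongr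
    have e : (1 / (ν * √N) * ζ s) ^ 2 = (1 - 1 / (N : ℝ)) * 0 + 1 / N * (ζ s ^ 2 / ν ^ 2) := by
      have : (√(N : ℝ)) ^ 2 = N := Real.sq_sqrt (by linarith)
      rw [mul_pow, div_pow, mul_pow, this]; field_simp; ring
    rw [e]
    refine (exp_convex_combo (by linarith) (by positivity) (by ring)).trans ?_
    simp
  have hint' : Integrable (fun s => (1 - 1 / (N : ℝ)) + 1 / N * Real.exp (ζ s ^ 2 / ν ^ 2)) P :=
    (integrable_const _).add (hζ.1.const_mul _)
  have hint : Integrable (fun s => 1 / (ν * √N) * ζ s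
      + ((1 - 1 / N) + 1 / N * Real.exp (ζ s ^ 2 / ν ^ 2))) P := (hi.const_mul _).add hint'
  calc _ ≤ ∫⁻ s, ENNReal.ofReal (1 / (ν * √N) * ζ s
          + ((1 - 1 / N) + 1 / N * Real.exp (ζ s ^ 2 / ν ^ 2))) ∂P :=
        lintegral_mono fun s => ENNReal.ofReal_le_ofReal (hpt s)
    _ = ENNReal.ofReal (∫ s, (1 / (ν * √N) * ζ s
          + ((1 - 1 / N) + 1 / N * Real.exp (ζ s ^ 2 / ν ^ 2))) ∂P) :=
        (ofReal_integral_eq_lintegral_ofReal hint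
          (Filter.Eventually.of_forall fun s => (Real.exp_pos _).le.trans (hpt s))).symm
    _ ≤ _ := by
        refine ENNReal.ofReal_le_ofReal ?_
        rw [integral_add (hi.const_mul _) hint',
          integral_add (integrable_const _) (hζ.1.const_mul _), integral_const_mul,
          integral_const_mul, h0]
        have h3 : 1 / (N : ℝ) * ∫ s, Real.exp (ζ s ^ 2 / ν ^ 2) ∂P ≤ 1 / N * 3 := by
          have := hζ.2.trans (Real.exp_one_lt_three.le)
          gcongr
        have h4 := Real.add_one_le_exp (2 / (N : ℝ))
        have h5 : 1 / (N : ℝ) * 3 = 1 / N + 2 / N := by ring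
        simp
        simp at h3 h5
        linarith

variable {Ω : Type*} {mΩ : MeasurableSpace Ω} {μ : Measure Ω} {ξ : ℕ → Ω → Ξ}

/-- Concentration for sums of conditionally centred light-tailed terms. -/
theorem measure_sum_ge_le [IsProbabilityMeasure μ] [IsProbabilityMeasure P]
    (hξm : ∀ k, Measurable (ξ k)) (hξ : ∀ k, HasLaw (ξ k) P μ) (hind : iIndepFun ξ μ)
    {S : Type*} [MeasurableSpace S] {W : ℕ → Ω → S}
    (hW : ∀ k, Measurable[pastAlgebra ξ k] (W k)) {ψ : S × Ξ → ℝ} (hψ : Measurable ψ) {ν : ℝ}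
    (hν : 0 < ν) (hlt : ∀ w, IsLightTailed (fun s => ψ (w, s)) ν P)
    (hi : ∀ w, Integrable (fun s => ψ (w, s)) P) (h0 : ∀ w, ∫ s, ψ (w, s) ∂P = 0)
    {N : ℕ} (hN : 0 < N) (L : ℝ) :
    μ {ω | ν * √N * L ≤ ∑ k ∈ Finset.range N, ψ (W k ω, ξ k ω)}
      ≤ ENNReal.ofReal (Real.exp (2 - L)) := by
  have hN' : (0 : ℝ) < N := by exact_mod_cast hN
  have h := lintegral_exp_sum_le (μ := μ) (P := P) hξm hξ hind hW (hψ.const_mul (1 / (ν * √N)))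
    (fun w => (hlt w).lintegral_exp_le hν (hi w) (h0 w) hN) N
  rw [mul_div_cancel₀ _ hN'.ne'] at h
  have hm : Measurable fun ω => ∑ k ∈ Finset.range N, 1 / (ν * √N) * ψ (W k ω, ξ k ω) :=
    (measurable_sum_past hW (hψ.const_mul (1 / (ν * √N))) N).mono (pastAlgebra_le hξm N) le_rfl
  rw [sub_eq_add_neg, Real.exp_add, ENNReal.ofReal_mul (Real.exp_pos _).le]
  refine le_trans (measure_mono fun ω hω => ?_)
    ((measure_ge_le_lintegral_exp_mul hm L).trans (mul_le_mul_left h _))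
  simp only [Set.mem_ofPred_eq, ← Finset.mul_sum] at hω ⊢
  rw [one_div, le_inv_mul_iff₀ (by positivity)]
  exact hω

end LightTail

/-! ### Exponential drift argument. -/

section Drift

variable {Ω Ξ : Type*} [MeasurableSpace Ξ] {P : Measure Ξ} {mΩ : MeasurableSpace Ω}
  {μ : Measure Ω} {ξ : ℕ → Ω → Ξ}

/-- If each step adds at most `C` to the exponential moment, then moments grow linearly. -/
theorem lintegral_exp_drift_le [IsProbabilityMeasure μ] [IsProbabilityMeasure P]
    (hξm : ∀ k, Measurable (ξ k)) (hξ : ∀ k, HasLaw (ξ k) P μ) (hind : iIndepFun ξ μ)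
    {S : Type*} [MeasurableSpace S] {W : ℕ → Ω → S}
    (hW : ∀ k, Measurable[pastAlgebra ξ k] (W k)) {w : S → ℝ} {b : S × Ξ → ℝ} (hb : Measurable b) (hstep : ∀ k ω, w (W (k + 1) ω) ≤ b (W k ω, ξ k ω))
    {r : ℝ} (hr : 0 ≤ r) {C : ENNReal}
    (hmgf : ∀ z, ∫⁻ s, ENNReal.ofReal (Real.exp (r * b (z, s))) ∂P
      ≤ ENNReal.ofReal (Real.exp (r * w z)) + C)
    (h0 : ∀ ω, ENNReal.ofReal (Real.exp (r * w (W 0 ω))) ≤ C) (k : ℕ) :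
    ∫⁻ ω, ENNReal.ofReal (Real.exp (r * w (W k ω))) ∂μ ≤ (k + 1) * C := by
  induction k with
  | zero =>
    calc _ ≤ ∫⁻ _, C ∂μ := lintegral_mono h0
      _ = _ := by simp
  | succ k ih =>
    have hWk : Measurable (W k) := (hW k).mono (pastAlgebra_le hξm k) le_rfl
    calc ∫⁻ ω, ENNReal.ofReal (Real.exp (r * w (W (k + 1) ω))) ∂μ
        ≤ ∫⁻ ω, ENNReal.ofReal (Real.exp (r * b (W k ω, ξ k ω))) ∂μ := by
          refine lintegral_mono fun ω => ENNReal.ofReal_le_ofReal (Real.exp_le_exp.2 ?_)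
          exact mul_le_mul_of_nonneg_left (hstep k ω) hr
      _ = ∫⁻ ω, ∫⁻ s, ENNReal.ofReal (Real.exp (r * b (W k ω, s))) ∂P ∂μ :=
          lintegral_past_eq hξm hξ hind (hW k)
            (h := fun q => ENNReal.ofReal (Real.exp (r * b q))) (by fun_prop)
      _ ≤ ∫⁻ ω, (ENNReal.ofReal (Real.exp (r * w (W k ω))) + C) ∂μ :=
          lintegral_mono fun ω => hmgf _
      _ ≤ (k + 1) * C + C := by
          rw [lintegral_add_right _ measurable_const]
          simpa using add_le_add_left ih C
      _ = _ := by push_cast; ring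

/-- The random bound on the next value of `√(t² + D²)` used in the drift argument. -/
noncomputable def driftBound (θ β σ A w q : ℝ) : ℝ :=
  if w < θ then θ + 2 * β else w + σ * (A + q) / w

/-- Above `θ` the square root is linearized through `2 w' w ≤ w'² + w²`. Below `θ` the increment of
the square is at most `3βθ`, which `(θ + 2β)²` absorbs. -/
theorem le_driftBound {θ β σ A ε ν t D w w' q : ℝ} (hσ : 0 < σ) (hσ1 : σ ≤ 1) (hε : 0 < ε)
    (hεβ : ε ≤ β) (hνβ : ν ≤ β) (hθ : 0 < θ) (hθA : 2 * A ≤ ε * θ) (ht : 0 ≤ t)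
    (hw0 : 0 ≤ w) (hw : w ^ 2 = t ^ 2 + D ^ 2) (hν : 0 ≤ ν) (hq : |q| ≤ ν * t)
    (h : w' ^ 2 ≤ w ^ 2 + 2 * σ * (A + q)) :
    w' ≤ driftBound θ β σ A w q := by
  unfold driftBound
  split_ifs with hlt
  · have htw : t ≤ w := abs_le_of_sq_le_sq' (by nlinarith) hw0 |>.2
    have hq' : q ≤ β * θ := (le_abs_self q).trans (hq.trans
      (mul_le_mul hνβ (htw.trans hlt.le) ht (hν.trans hνβ)))
    have hA' : 2 * A ≤ β * θ := hθA.trans (mul_le_mul_of_nonneg_right hεβ hθ.le)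
    have hβ : 0 < β := hε.trans_le hεβ
    have hβθ : 0 < β * θ := by positivity
    refine abs_le_of_sq_le_sq' ?_ (by positivity) |>.2
    have h1 : σ * (2 * A + 2 * q) ≤ 1 * (3 * (β * θ)) := by
      calc σ * (2 * A + 2 * q) ≤ σ * (3 * (β * θ)) :=
            mul_le_mul_of_nonneg_left (by linarith) hσ.le
        _ ≤ _ := mul_le_mul_of_nonneg_right hσ1 (by positivity)
    have h2 : w ^ 2 ≤ θ ^ 2 := by gcongr
    nlinarith
  · have hwpos : 0 < w := hθ.trans_le (not_lt.1 hlt)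
    have h1 : w' * w ≤ w * w + σ * (A + q) := by nlinarith [sq_nonneg (w' - w)]
    have : w + σ * (A + q) / w = (w * w + σ * (A + q)) / w := by field_simp
    rw [this, le_div_iff₀ hwpos]
    exact h1

/-- Above `θ` the first summand alone suffices, below it the second. The rate `ε / (4β²)` makes the
second-order term of the exponential at most a quarter of `ε w`, in units of `c`. -/
theorem lintegral_exp_driftBound_le [IsProbabilityMeasure P] {θ β σ A ε ν t D R w : ℝ}
    (hσ : 0 < σ) (hσ1 : σ ≤ 1) (hε : 0 < ε) (hεβ : ε ≤ β) (hν : 0 ≤ ν) (hνβ : ν ≤ β)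
    (hθ : 0 < θ) (hθA : 2 * A ≤ ε * θ) (hθR : 2 * R ≤ θ) (hD : 0 ≤ D) (hDR : D ≤ R) (ht : 0 ≤ t)
    (hw0 : 0 ≤ w) (hw : w ^ 2 = t ^ 2 + D ^ 2) {q : Ξ → ℝ} (hqm : Measurable q)
    (hq : ∀ s, |q s| ≤ ν * t) (hqi : ∫ s, q s ∂P ≤ -(ε * t)) :
    ∫⁻ s, ENNReal.ofReal (Real.exp (ε / (4 * β ^ 2) * driftBound θ β σ A w (q s))) ∂P
      ≤ ENNReal.ofReal (Real.exp (ε / (4 * β ^ 2) * w))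
        + ENNReal.ofReal (Real.exp (ε / (4 * β ^ 2) * (θ + 2 * β))) := by
  set r := ε / (4 * β ^ 2) with hr
  have hβ : 0 < β := hε.trans_le hεβ
  have hr0 : 0 < r := by positivity
  by_cases hlt : w < θ
  · simp only [driftBound, if_pos hlt, lintegral_const, measure_univ, mul_one]
    exact le_add_self
  refine le_trans ?_ le_self_add
  have hθw := not_lt.1 hlt
  have hwpos : 0 < w := hθ.trans_le hθw
  have htw : t ≤ w := abs_le_of_sq_le_sq' (by nlinarith) hw0 |>.2
  -- Since `D ≤ R ≤ θ/2 ≤ w/2`, most of `w` comes from the multiplier.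
  have ht34 : 3 / 4 * w ≤ t := by
    have h1 : D ^ 2 ≤ (w / 2) ^ 2 := by
      have : D ≤ w / 2 := by linarith
      gcongr
    nlinarith
  have hqI : Integrable q P := Integrable.of_bound hqm.aestronglyMeasurable (ν * t)
    (Filter.Eventually.of_forall hq)
  set c := r * σ / w with hc
  have hc0 : 0 < c := by positivity
  set v := r * σ * ν with hv
  have hv0 : 0 ≤ v := by positivity
  have hrβ : r * β ^ 2 = ε / 4 := by rw [hr]; field_simp
  have hv1 : v ≤ 1 := by
    have h1 : r * σ * ν ≤ r * 1 * β := by gcongr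
    have h2 : r * β ≤ 1 := by
      rw [hr, div_mul_eq_mul_div, div_le_one (by positivity)]; nlinarith
    linarith
  have hcq : ∀ s, |c * q s| ≤ v := by
    intro s
    rw [abs_mul, abs_of_pos hc0, hc, hv, div_mul_eq_mul_div, div_le_iff₀ hwpos]
    have h1 : |q s| ≤ ν * w := (hq s).trans (mul_le_mul_of_nonneg_left htw hν)
    calc r * σ * |q s| ≤ r * σ * (ν * w) := by gcongr
      _ = _ := by ring
  have hpt : ∀ s, Real.exp (r * driftBound θ β σ A w (q s))
      ≤ Real.exp (r * w + c * A) * (1 + c * q s + v ^ 2) := by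
    intro s
    have e : r * driftBound θ β σ A w (q s) = (r * w + c * A) + c * q s := by
      rw [driftBound, if_neg hlt, hc]; field_simp; ring
    rw [e, Real.exp_add]
    gcongr
    have h1 := abs_le.1 (Real.abs_exp_sub_one_sub_id_le ((hcq s).trans hv1))
    have h2 : (c * q s) ^ 2 ≤ v ^ 2 := by rw [← sq_abs]; have := hcq s; gcongr
    linarith [h1.2]
  have hint' : Integrable (fun s => 1 + c * q s) P := (integrable_const _).add (hqI.const_mul c)
  have hint : Integrable (fun s => 1 + c * q s + v ^ 2) P := hint'.add (integrable_const _)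
  calc _ ≤ ∫⁻ s, ENNReal.ofReal (Real.exp (r * w + c * A) * (1 + c * q s + v ^ 2)) ∂P :=
        lintegral_mono fun s => ENNReal.ofReal_le_ofReal (hpt s)
    _ = ENNReal.ofReal (∫ s, Real.exp (r * w + c * A) * (1 + c * q s + v ^ 2) ∂P) :=
        (ofReal_integral_eq_lintegral_ofReal (hint.const_mul _)
          (Filter.Eventually.of_forall fun s => (Real.exp_pos _).le.trans (hpt s))).symm
    _ ≤ _ := by
        refine ENNReal.ofReal_le_ofReal ?_
        rw [integral_const_mul, integral_add hint' (integrable_const _),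
          integral_add (integrable_const _) (hqI.const_mul c), integral_const_mul]
        simp only [integral_const, probReal_univ, one_smul]
        have h1 : 1 + c * ∫ s, q s ∂P + v ^ 2 ≤ Real.exp (c * -(ε * t) + v ^ 2) := by
          have h2 := Real.add_one_le_exp (c * -(ε * t) + v ^ 2)
          have h3 := mul_le_mul_of_nonneg_left hqi hc0.le
          linarith
        refine (mul_le_mul_of_nonneg_left h1 (Real.exp_pos _).le).trans ?_
        rw [← Real.exp_add, Real.exp_le_exp]
        have h4 : v ^ 2 ≤ c * (ε / 4 * w) := by
          have e : c * (ε / 4 * w) = r * σ * (ε / 4) := by rw [hc]; field_simp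
          have e2 : v ^ 2 = r * σ * (r * (σ * ν ^ 2)) := by rw [hv]; ring
          rw [e, e2, ← hrβ]
          have h5 : σ * ν ^ 2 ≤ 1 * β ^ 2 := by gcongr
          rw [one_mul] at h5
          gcongr
        -- The balance is `1/2 - 3/4 + 1/4 = 0` in units of `ε w`, using `2A ≤ εθ ≤ εw`.
        have h6 : A - ε * t + ε / 4 * w ≤ 0 := by nlinarith
        have h7 := mul_nonpos_of_nonneg_of_nonpos hc0.le h6
        linarith

end Drift

/-! ### The iterates are adapted to the samples. -/

section Adapted

variable {E V Ω Ξ : Type*} [NormedAddCommGroup E] [InnerProductSpace ℝ E] [CompleteSpace E]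
  [SecondCountableTopology E] [MeasurableSpace E] [BorelSpace E]
  [NormedAddCommGroup V] [InnerProductSpace ℝ V] [FiniteDimensional ℝ V]
  [SecondCountableTopology V] [MeasurableSpace V] [BorelSpace V] [MeasurableSpace Ξ]
  {F : E → Ξ → ℝ} {G : E → Ξ → V} {X O : Set E} {K : ProperCone ℝ V} {R νg κf κg σ : ℝ}
  {x₁ : E} {ξ : ℕ → Ω → Ξ} {x : ℕ → Ω → E} {y : ℕ → Ω → V}

omit [SecondCountableTopology V] in
theorem Measurable.augPenalty {α : Type*} [MeasurableSpace α] {f g : α → V}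
    (hf : Measurable f) (hg : Measurable g) (σ : ℝ) :
    Measurable fun a => augPenalty K σ (f a) (g a) := by
  have h := (continuous_metricProj K).measurable.comp (hf.add (hg.const_smul σ))
  exact measurable_const.mul ((h.norm.pow_const 2).sub (hf.norm.pow_const 2))

theorem IsBoundedConvexSample.measurable_run (H : IsBoundedConvexSample F G X O K R νg κf κg)
    (hFm : ∀ x ∈ O, Measurable (F x)) (hGm : ∀ x ∈ O, Measurable (G x)) (hσ : 0 < σ)
    (hx₁ : x₁ ∈ X)
    (hrun : ∀ ω, IsLSAALRun F G X K σ x₁ (fun k => ξ k ω) (fun k => x k ω) (fun k => y k ω))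
    (k : ℕ) : Measurable[pastAlgebra ξ k] (x k) ∧ Measurable[pastAlgebra ξ k] (y k) := by
  induction k with
  | zero =>
    have h1 : x 0 = fun _ => x₁ := funext fun ω => (hrun ω).x_init
    have h2 : y 0 = fun _ => 0 := funext fun ω => (hrun ω).y_init
    rw [h1, h2]
    exact ⟨measurable_const, measurable_const⟩
  | succ k ih =>
    have hmem : ∀ ω, x k ω ∈ X := fun ω => (hrun ω).x_mem' hx₁ k
    -- From here on, measurability is relative to the samples of index at most `k`, exactly those
    -- that determine iterate `k + 1`.
    let _ : MeasurableSpace Ω := pastAlgebra ξ (k + 1)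
    have hx : Measurable (x k) := ih.1.mono (pastAlgebra_mono ξ k.le_succ) le_rfl
    have hy : Measurable (y k) := ih.2.mono (pastAlgebra_mono ξ k.le_succ) le_rfl
    have hξk : Measurable (ξ k) := measurable_pastAlgebra ξ k
    have hF : ∀ u, Measurable fun ω => linF F (ξ k ω) (x k ω) u := by
      intro u
      have := (measurable_linG (X := X) H.isOpen H.subset hFm H.contDiffOn_F).comp
        (((hx.subtype_mk (h := hmem)).prodMk (measurable_const (a := u))).prodMk hξk)
      simpa only [linF, inner_gradient_eq_fderiv, Function.comp_def] using this
    have hG : ∀ u : Ω → E, Measurable u → Measurable fun ω => linG G (ξ k ω) (x k ω) (u ω) :=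
      fun u hu => (measurable_linG (X := X) H.isOpen H.subset hGm H.contDiffOn_G).comp
        (((hx.subtype_mk (h := hmem)).prodMk hu).prodMk hξk)
    have hxm : ∀ ω, x (k + 1) ω ∈ X := fun ω => (hrun ω).x_mem k
    have hxk : Measurable (x (k + 1)) := by
      refine measurable_of_quadratic_growth (X := X) (c := 1 / (2 * σ))
        (h := fun u ω => linF F (ξ k ω) (x k ω) u
          + augPenalty K σ (y k ω) (linG G (ξ k ω) (x k ω) u)
          + 1 / (2 * σ) * ‖u - x k ω‖ ^ 2) (by positivity) hxm
        (fun u _ => ?_) (fun ω => ?_) (fun ω u hu => ?_)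
      · have h1 := hy.augPenalty (K := K) (hG (fun _ => u) measurable_const) σ
        have h2 : Measurable fun ω => 1 / (2 * σ) * ‖u - x k ω‖ ^ 2 := by fun_prop
        exact ((hF u).add h1).add h2
      · have hl : Continuous fun u => linG G (ξ k ω) (x k ω) u := by unfold linG; fun_prop
        have h1 := (continuous_const (y := y k ω)).augPenalty (K := K) hl σ
        have h2 : Continuous fun u => linF F (ξ k ω) (x k ω) u := by unfold linF; fun_prop
        have h3 : Continuous fun u : E => 1 / (2 * σ) * ‖u - x k ω‖ ^ 2 := by fun_prop
        exact ((h2.add h1).add h3).continuousOn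
      · have hst := (hrun ω).x_step k
        exact subproblem_growth (F := F) (G := G) (K := K) (s := ξ k ω) (c := x k ω) (y := y k ω)
          (p := x (k + 1) ω) H.convex hσ (hxm ω) hst hu
    refine ⟨hxk, ?_⟩
    have h1 : y (k + 1) = fun ω => metricProj (polarCone K)
        (y k ω + σ • linG G (ξ k ω) (x k ω) (x (k + 1) ω)) :=
      funext fun ω => (hrun ω).y_step k
    rw [h1]
    exact (continuous_metricProj K).measurable.comp (hy.add ((hG _ hxk).const_smul σ))

end Adapted

/-! ### From the minimax gap to averaged Lagrangian gaps. -/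

section Expectation

variable {E V Ξ : Type*} [NormedAddCommGroup E] [InnerProductSpace ℝ E] [MeasurableSpace Ξ]
  [NormedAddCommGroup V] [InnerProductSpace ℝ V] [FiniteDimensional ℝ V]
  {P : Measure Ξ} {F : E → Ξ → ℝ} {G : E → Ξ → V} {O : Set E} {K : ProperCone ℝ V}

omit [FiniteDimensional ℝ V] in
theorem convexOn_expVal_add_inner [CompleteSpace V] (hO : Convex ℝ O)
    (hFi : ∀ x ∈ O, Integrable (F x) P) (hGi : ∀ x ∈ O, Integrable (G x) P)
    (hFc : ∀ s, ConvexOn ℝ O (fun x => F x s)) (hGc : ∀ s, IsGraphConvexOn K O (fun x => G x s))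
    {v : V} (hv : v ∈ polarCone K) :
    ConvexOn ℝ O (fun x => expVal P F x + inner ℝ v (expVal P G x)) := by
  have hi : ∀ x ∈ O, Integrable (fun s => F x s + inner ℝ v (G x s)) P := fun x hx =>
    (hFi x hx).add ((hGi x hx).const_inner v)
  have he : ∀ x ∈ O, expVal P F x + inner ℝ v (expVal P G x)
      = ∫ s, (F x s + inner ℝ v (G x s)) ∂P := fun x hx => by
    rw [integral_add (hFi x hx) ((hGi x hx).const_inner v), integral_inner (hGi x hx)]
    rfl
  refine ⟨hO, fun x hx w hw a b ha hb hab => ?_⟩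
  have hm := hO hx hw ha hb hab
  beta_reduce
  rw [he _ hm, he x hx, he w hw, smul_eq_mul, smul_eq_mul, ← integral_const_mul,
    ← integral_const_mul, ← integral_add ((hi x hx).const_mul a) ((hi w hw).const_mul b)]
  refine integral_mono (hi _ hm) (((hi x hx).const_mul a).add ((hi w hw).const_mul b)) fun s => ?_
  have := ((hFc s).add ((hGc s).convexOn_inner hO hv)).2 hx hw ha hb hab
  simpa using this

/-- The minimax gap at the averaged iterates is at most the averaged Lagrangian gap. -/
theorem minimaxGap_avgIter_le {X : Set E} {f : E → ℝ} {g : E → V} (hX : Convex ℝ X)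
    {σ νg : ℝ} (hσ : 0 < σ) {u : E} {v : V}
    (hconv : ConvexOn ℝ X (fun x => f x + inner ℝ v (g x))) (hg : ∀ x ∈ X, ‖g x‖ ≤ νg)
    {x : ℕ → E} {y : ℕ → V} (hx : ∀ k, x k ∈ X) (hy : ∀ k, y k ∈ polarCone K) {N : ℕ}
    (hN : 0 < N) :
    minimaxGap (augLagrangian K σ f g) u v (avgIter N x) (avgIter N y)
      ≤ 1 / N * ∑ k ∈ Finset.range N, (f (x k) + inner ℝ v (g (x k)) - f u - inner ℝ (y k) (g u))
        + σ / 2 * νg ^ 2 := by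
  have hN' : (0 : ℝ) < N := by exact_mod_cast hN
  have hw : ∑ _k ∈ Finset.range N, 1 / (N : ℝ) = 1 := by simp [hN'.ne']
  have hmem : avgIter N x ∈ X := by
    rw [avgIter, Finset.smul_sum]
    exact hX.sum_mem (fun _ _ => by positivity) hw fun k _ => hx k
  have h1 : f (avgIter N x) + inner ℝ v (g (avgIter N x))
      ≤ ∑ k ∈ Finset.range N, 1 / (N : ℝ) * (f (x k) + inner ℝ v (g (x k))) := by
    have := hconv.map_sum_le (t := Finset.range N) (w := fun _ => 1 / (N : ℝ)) (p := x)
      (fun _ _ => by positivity) hw (fun k _ => hx k)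
    rw [avgIter, Finset.smul_sum]
    simpa only [smul_eq_mul] using this
  -- The penalty is bounded above at the averaged point and below at the averaged multiplier; the
  -- lower bound needs the average to be polar.
  have h2 := augPenalty_le (K := K) hσ v (g (avgIter N x))
  have h3 := inner_le_augPenalty hσ (g u) (avgIter_mem_polarCone (N := N) hy)
  have h4 : inner ℝ (avgIter N y) (g u)
      = ∑ k ∈ Finset.range N, 1 / (N : ℝ) * inner ℝ (y k) (g u) := by
    rw [avgIter, real_inner_smul_left, sum_inner, Finset.mul_sum]
  have h5 : ∑ k ∈ Finset.range N, 1 / (N : ℝ) * f u = f u := by rw [← Finset.sum_mul, hw, one_mul]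
  have h6 : σ / 2 * ‖g (avgIter N x)‖ ^ 2 ≤ σ / 2 * νg ^ 2 := by
    have := hg _ hmem
    gcongr
  have h7 : 1 / (N : ℝ) * ∑ k ∈ Finset.range N,
        (f (x k) + inner ℝ v (g (x k)) - f u - inner ℝ (y k) (g u))
      = ∑ k ∈ Finset.range N, 1 / (N : ℝ) * (f (x k) + inner ℝ v (g (x k)))
        - ∑ k ∈ Finset.range N, 1 / (N : ℝ) * f u
        - ∑ k ∈ Finset.range N, 1 / (N : ℝ) * inner ℝ (y k) (g u) := by
    rw [Finset.mul_sum, ← Finset.sum_sub_distrib, ← Finset.sum_sub_distrib]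
    exact Finset.sum_congr rfl fun k _ => by ring
  rw [h7, h5, ← h4]
  change f (avgIter N x) + augPenalty K σ v (g (avgIter N x))
    - (f u + augPenalty K σ (avgIter N y) (g u)) ≤ _
  linarith

end Expectation

theorem measurable_state {E V Ω : Type*} [MeasurableSpace E] [MeasurableSpace V] {A : Set E}
    {B : Set V} {m : MeasurableSpace Ω} {a : Ω → E} {b : Ω → V} (ha : Measurable a)
    (hb : Measurable b) (hA : ∀ ω, a ω ∈ A) (hB : ∀ ω, b ω ∈ B) :
    Measurable fun ω => ((⟨a ω, hA ω⟩, ⟨b ω, hB ω⟩) : A × B) :=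
  (ha.subtype_mk).prodMk (hb.subtype_mk)

/-! ### Tails of the multipliers and of the accumulated noise. -/

section Probability

variable {E V Ω Ξ : Type*} [NormedAddCommGroup E] [InnerProductSpace ℝ E] [CompleteSpace E]
  [SecondCountableTopology E] [MeasurableSpace E] [BorelSpace E]
  [NormedAddCommGroup V] [InnerProductSpace ℝ V] [FiniteDimensional ℝ V]
  [SecondCountableTopology V] [MeasurableSpace V] [BorelSpace V] [MeasurableSpace Ξ]
  {F : E → Ξ → ℝ} {G : E → Ξ → V} {X O : Set E} {K : ProperCone ℝ V} {R νg κf κg σ : ℝ}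
  {P : Measure Ξ} [IsProbabilityMeasure P] {mΩ : MeasurableSpace Ω} {μ : Measure Ω}
  [IsProbabilityMeasure μ] {x₁ : E} {ξ : ℕ → Ω → Ξ} {x : ℕ → Ω → E} {y : ℕ → Ω → V}

/-- Under the Slater condition the multipliers have uniformly light tails. -/
theorem IsBoundedConvexSample.measure_exists_le_norm_y
    (H : IsBoundedConvexSample F G X O K R νg κf κg)
    (hFm : ∀ x ∈ O, Measurable (F x)) (hGm : ∀ x ∈ O, Measurable (G x)) (hσ : 0 < σ)
    (hσ1 : σ ≤ 1) (hx₁ : x₁ ∈ X)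
    (hrun : ∀ ω, IsLSAALRun F G X K σ x₁ (fun k => ξ k ω) (fun k => x k ω) (fun k => y k ω))
    (hξm : ∀ k, Measurable (ξ k)) (hξ : ∀ k, HasLaw (ξ k) P μ) (hind : iIndepFun ξ μ)
    (hR : 0 ≤ R) (hνg : 0 ≤ νg) (hκf : 0 ≤ κf) {xhat : E} (hxhat : xhat ∈ X)
    {ε β : ℝ} (hε : 0 < ε) (hsl : Metric.closedBall (expVal P G xhat) ε ⊆ (K : Set V))
    (hεβ : ε ≤ β) (hνβ : νg ≤ β) (N : ℕ) (B : ℝ) :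
    μ {ω | ∃ k < N, B ≤ ‖y k ω‖} ≤ ENNReal.ofReal ((N : ℝ) ^ 2 * Real.exp (ε / (4 * β ^ 2)
      * (((2 * (κf * R + σ / 2 * νg ^ 2) + R ^ 2) / ε + ε) + 2 * β - B))) := by
  set A := κf * R + σ / 2 * νg ^ 2 with hA
  set θ := (2 * A + R ^ 2) / ε + ε with hθ
  set r := ε / (4 * β ^ 2) with hr
  have hβ : 0 < β := hε.trans_le hεβ
  have hA0 : 0 ≤ A := by positivity
  have hr0 : 0 < r := by positivity
  have hθ0 : 0 < θ := by positivity
  have hεθ : ε * θ = 2 * A + R ^ 2 + ε ^ 2 := by rw [hθ]; field_simp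
  have hθA : 2 * A ≤ ε * θ := by nlinarith
  -- The terms `R²/ε + ε` in `θ` are there for this, by the arithmetic-geometric mean inequality.
  have hθR : 2 * R ≤ θ := by
    refine le_of_mul_le_mul_left ?_ hε
    rw [hεθ]
    nlinarith [sq_nonneg (R - ε)]
  have hxm : ∀ k ω, x k ω ∈ X := fun k ω => (hrun ω).x_mem' hx₁ k
  have hym : ∀ k ω, y k ω ∈ polarCone K := fun k ω => (hrun ω).y_mem k
  let W : ℕ → Ω → X × polarCone K := fun k ω => (⟨x k ω, hxm k ω⟩, ⟨y k ω, hym k ω⟩)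
  have hW : ∀ k, Measurable[pastAlgebra ξ k] (W k) := fun k => by
    obtain ⟨h1, h2⟩ := H.measurable_run hFm hGm hσ hx₁ hrun k
    exact measurable_state h1 h2 (hxm k) (hym k)
  let w : X × polarCone K → ℝ := fun z => √(‖(z.2 : V)‖ ^ 2 + ‖xhat - z.1‖ ^ 2)
  have hw : Measurable w := by fun_prop
  have hwsq : ∀ z, w z ^ 2 = ‖(z.2 : V)‖ ^ 2 + ‖xhat - z.1‖ ^ 2 := fun z =>
    Real.sq_sqrt (by positivity)
  have hw0 : ∀ z, 0 ≤ w z := fun z => Real.sqrt_nonneg _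
  let q : (X × polarCone K) × Ξ → ℝ := fun p => inner ℝ (p.1.2 : V) (G xhat p.2)
  have hGx : Measurable (G xhat) := hGm _ (H.subset hxhat)
  have hq : Measurable q := by fun_prop
  have hqb : ∀ p, |q p| ≤ νg * ‖(p.1.2 : V)‖ := fun p => by
    refine (abs_real_inner_le_norm _ _).trans ?_
    rw [mul_comm]
    exact mul_le_mul_of_nonneg_right (H.norm_G_le _ _ (H.subset hxhat)) (norm_nonneg _)
  have hGi : Integrable (G xhat) P := Integrable.of_bound hGx.aestronglyMeasurable νg
    (Filter.Eventually.of_forall fun s => H.norm_G_le s _ (H.subset hxhat))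
  have hqi : ∀ z, ∫ s, q (z, s) ∂P ≤ -(ε * ‖(z.2 : V)‖) := fun z => by
    have h1 : ∫ s, q (z, s) ∂P = inner ℝ (z.2 : V) (expVal P G xhat) :=
      integral_inner (𝕜 := ℝ) hGi (z.2 : V)
    rw [h1]
    exact inner_le_of_closedBall_subset hε hsl z.2.2
  let b : (X × polarCone K) × Ξ → ℝ := fun p => driftBound θ β σ A (w p.1) (q p)
  have hb : Measurable b := by
    refine Measurable.ite (measurableSet_lt (hw.comp measurable_fst) measurable_const)
      measurable_const ?_
    fun_prop
  have hstep : ∀ k ω, w (W (k + 1) ω) ≤ b (W k ω, ξ k ω) := by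
    intro k ω
    refine le_driftBound (ε := ε) (ν := νg) (t := ‖y k ω‖) (D := ‖xhat - x k ω‖) hσ hσ1 hε hεβ
      hνβ hθ0 hθA (norm_nonneg _) (hw0 _) (hwsq _) hνg (hqb _) ?_
    rw [hwsq, hwsq]
    have := H.sq_add_sq_step_le (u := xhat) hσ (hxm k ω) ((hrun ω).x_mem k) ((hrun ω).x_step k)
      hxhat
    rw [← (hrun ω).y_step k] at this
    exact this
  set C := ENNReal.ofReal (Real.exp (r * (θ + 2 * β))) with hC
  have hmgf : ∀ z, ∫⁻ s, ENNReal.ofReal (Real.exp (r * b (z, s))) ∂P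
      ≤ ENNReal.ofReal (Real.exp (r * w z)) + C := fun z =>
    lintegral_exp_driftBound_le (R := R) hσ hσ1 hε hεβ hνg hνβ hθ0 hθA hθR
      (norm_nonneg (xhat - z.1)) (H.diam_le _ hxhat _ z.1.2) (norm_nonneg (z.2 : V)) (hw0 z)
      (hwsq z) (hq.comp measurable_prodMk_left) (fun s => hqb (z, s)) (hqi z)
  have h0 : ∀ ω, ENNReal.ofReal (Real.exp (r * w (W 0 ω))) ≤ C := by
    intro ω
    refine ENNReal.ofReal_le_ofReal (Real.exp_le_exp.2 (mul_le_mul_of_nonneg_left ?_ hr0.le))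
    have h1 : w (W 0 ω) ≤ R := by
      refine abs_le_of_sq_le_sq' ?_ hR |>.2
      rw [hwsq]
      change ‖y 0 ω‖ ^ 2 + ‖xhat - x 0 ω‖ ^ 2 ≤ R ^ 2
      rw [(hrun ω).y_init, norm_zero]
      have := H.diam_le _ hxhat _ (hxm 0 ω)
      have : ‖xhat - x 0 ω‖ ^ 2 ≤ R ^ 2 := by gcongr
      linarith
    linarith
  -- One factor `N` comes from the linear growth of the moments; the union over `k` contributes the
  -- other.
  have htail : ∀ k < N, μ {ω | B ≤ ‖y k ω‖} ≤ N * (C * ENNReal.ofReal (Real.exp (-(r * B)))) := by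
    intro k hk
    have hm : Measurable fun ω => r * w (W k ω) :=
      (hw.comp ((hW k).mono (pastAlgebra_le hξm k) le_rfl)).const_mul r
    calc μ {ω | B ≤ ‖y k ω‖} ≤ μ {ω | r * B ≤ r * w (W k ω)} := by
          refine measure_mono fun ω (hω : B ≤ ‖y k ω‖) => ?_
          have h1 : ‖y k ω‖ ≤ w (W k ω) := Real.le_sqrt_of_sq_le (by simp [W])
          exact mul_le_mul_of_nonneg_left (hω.trans h1) hr0.le
      _ ≤ _ := measure_ge_le_lintegral_exp_mul hm _
      _ ≤ ((k + 1) * C) * ENNReal.ofReal (Real.exp (-(r * B))) :=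
          mul_le_mul_left (lintegral_exp_drift_le hξm hξ hind hW hb hstep hr0.le hmgf h0 k) _
      _ ≤ N * C * ENNReal.ofReal (Real.exp (-(r * B))) := by
          gcongr
          exact_mod_cast hk
      _ = _ := mul_assoc _ _ _
  calc μ {ω | ∃ k < N, B ≤ ‖y k ω‖} ≤ μ (⋃ k ∈ Finset.range N, {ω | B ≤ ‖y k ω‖}) := by
        refine measure_mono fun ω ⟨k, hk, hω⟩ => ?_
        simp only [Set.mem_iUnion]
        exact ⟨k, Finset.mem_range.2 hk, hω⟩
    _ ≤ ∑ k ∈ Finset.range N, μ {ω | B ≤ ‖y k ω‖} := measure_biUnion_finset_le _ _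
    _ ≤ ∑ k ∈ Finset.range N, N * (C * ENNReal.ofReal (Real.exp (-(r * B)))) :=
        Finset.sum_le_sum fun k hk => htail k (Finset.mem_range.1 hk)
    _ = _ := by
        rw [Finset.sum_const, Finset.card_range, nsmul_eq_mul, hC,
          ← ENNReal.ofReal_mul (Real.exp_pos _).le, ← Real.exp_add,
          ENNReal.ofReal_mul (by positivity), ENNReal.ofReal_pow (by positivity),
          ENNReal.ofReal_natCast, sq, mul_assoc]
        ring_nf

/-- The stochastic error of the `k`-th step, with the multiplier truncated at level `B`. -/
noncomputable def stepError (P : Measure Ξ) (F : E → Ξ → ℝ) (G : E → Ξ → V) (B : ℝ) (u : E)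
    (v : V) (c : E) (y : V) (s : Ξ) : ℝ :=
  ((F u s - expVal P F u) - (F c s - expVal P F c))
    + (-inner ℝ v (G c s - expVal P G c)
      + inner ℝ (if ‖y‖ ≤ B then y else 0) (G u s - expVal P G u))

/-- Truncation makes the scale uniform over all states: `2 νf` for the two objective terms and `2 νg
(‖v‖ + B)` for the constraint terms. The truncated multiplier is still determined by the past, so
the noise remains conditionally centred. -/
theorem IsBoundedConvexSample.measure_sum_stepError
    (H : IsBoundedConvexSample F G X O K R νg κf κg)
    (hFm : ∀ x ∈ O, Measurable (F x)) (hGm : ∀ x ∈ O, Measurable (G x)) (hσ : 0 < σ)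
    (hx₁ : x₁ ∈ X)
    (hrun : ∀ ω, IsLSAALRun F G X K σ x₁ (fun k => ξ k ω) (fun k => x k ω) (fun k => y k ω))
    (hξm : ∀ k, Measurable (ξ k)) (hξ : ∀ k, HasLaw (ξ k) P μ) (hind : iIndepFun ξ μ)
    (hFi : ∀ x ∈ O, Integrable (F x) P)
    (hfc : ContinuousOn (expVal P F) X) (hgc : ContinuousOn (expVal P G) X)
    (hνg : 0 ≤ νg) {νf : ℝ} (hνf : 0 < νf)
    (hlt : ∀ x ∈ X, IsLightTailed (fun s => F x s - expVal P F x) νf P)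
    {u : E} (hu : u ∈ X) (v : V) {B : ℝ} (hB : 0 ≤ B) {N : ℕ} (hN : 0 < N) (L : ℝ) :
    μ {ω | (2 * νf + 2 * νg * (‖v‖ + B)) * √N * L
        ≤ ∑ k ∈ Finset.range N, stepError P F G B u v (x k ω) (y k ω) (ξ k ω)}
      ≤ ENNReal.ofReal (Real.exp (2 - L)) := by
  have hxm : ∀ k ω, x k ω ∈ X := fun k ω => (hrun ω).x_mem' hx₁ k
  let W : ℕ → Ω → X × V := fun k ω => (⟨x k ω, hxm k ω⟩, y k ω)
  have hW : ∀ k, Measurable[pastAlgebra ξ k] (W k) := fun k => by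
    obtain ⟨h1, h2⟩ := H.measurable_run hFm hGm hσ hx₁ hrun k
    exact h1.subtype_mk.prodMk h2
  let ψ : (X × V) × Ξ → ℝ := fun p => stepError P F G B u v p.1.1 p.1.2 p.2
  have hGi : ∀ c ∈ O, Integrable (G c) P := fun c hc =>
    Integrable.of_bound (hGm c hc).aestronglyMeasurable νg
      (Filter.Eventually.of_forall fun s => H.norm_G_le s c hc)
  have hgn : ∀ c ∈ O, ‖expVal P G c‖ ≤ νg := fun c hc =>
    (norm_integral_le_of_norm_le_const (μ := P)
      (Filter.Eventually.of_forall fun s => H.norm_G_le s c hc)).trans (by simp)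
  have hdiff : ∀ c ∈ O, ∀ s, ‖G c s - expVal P G c‖ ≤ 2 * νg := fun c hc s =>
    (norm_sub_le _ _).trans (by linarith [hgn c hc, H.norm_G_le s c hc])
  have hFu := hFm u (H.subset hu)
  have hGu := hGm u (H.subset hu)
  have hψ : Measurable ψ := by
    have h1 : Measurable fun p : X × Ξ => F p.1 p.2 :=
      measurable_uncurry_of_continuous_of_measurable (u := fun (c : X) s => F c s)
        (fun s => continuousOn_iff_continuous_domRestrict.1
          ((H.contDiffOn_F s).continuousOn.mono H.subset)) fun c => hFm c (H.subset c.2)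
    have h2 : Measurable fun p : X × Ξ => G p.1 p.2 :=
      measurable_uncurry_of_continuous_of_measurable (u := fun (c : X) s => G c s)
        (fun s => continuousOn_iff_continuous_domRestrict.1
          ((H.contDiffOn_G s).continuousOn.mono H.subset)) fun c => hGm c (H.subset c.2)
    have h3 : Measurable fun c : X => expVal P F c :=
      (continuousOn_iff_continuous_domRestrict.1 hfc).measurable
    have h4 : Measurable fun c : X => expVal P G c :=
      (continuousOn_iff_continuous_domRestrict.1 hgc).measurable
    have hp : Measurable fun p : (X × V) × Ξ => (p.1.1, p.2) := by fun_prop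
    have hp1 : Measurable fun p : (X × V) × Ξ => p.1.1 := by fun_prop
    have h5 := h1.comp hp
    have h6 := h2.comp hp
    have h7 := h3.comp hp1
    have h8 := h4.comp hp1
    have h9 : Measurable fun p : (X × V) × Ξ =>
        if ‖p.1.2‖ ≤ B then p.1.2 else 0 :=
      Measurable.ite (measurableSet_le (by fun_prop) measurable_const) (by fun_prop)
        measurable_const
    exact (((hFu.comp measurable_snd).sub_const _).sub (h5.sub h7)).add
      ((measurable_const.inner (h6.sub h8)).neg.add
        (h9.inner ((hGu.comp measurable_snd).sub_const _)))
  have htr : ∀ z : V, ‖(if ‖z‖ ≤ B then z else 0)‖ ≤ B := fun z => by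
    split_ifs with h
    · exact h
    · simpa using hB
  have hc0 : 0 ≤ 2 * νg * (‖v‖ + B) := by positivity
  refine measure_sum_ge_le hξm hξ hind hW hψ (by positivity) (fun z => ?_) (fun z => ?_)
    (fun z => ?_) hN L
  · have hcX := z.1.2
    have hcO := H.subset hcX
    refine IsLightTailed.add_bounded (by positivity) hc0
      (IsLightTailed.sub hνf (hlt u hu) (hlt z.1 hcX) (hFu.sub_const _)
        ((hFm z.1 hcO).sub_const (expVal P F z.1))) ((hFu.sub_const _).sub ((hFm z.1 hcO).sub_const (expVal P F z.1))) ?_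
      fun s => ?_
    · have hGz := hGm z.1 hcO
      have m1 : Measurable fun s => inner ℝ v (G z.1 s - expVal P G z.1) := by fun_prop
      have m2 : Measurable fun s => inner ℝ (if ‖z.2‖ ≤ B then z.2 else 0)
        (G u s - expVal P G u) := by fun_prop
      exact m1.neg.add m2
    · refine (abs_add_le _ _).trans ?_
      rw [abs_neg]
      have h1 : |inner ℝ v (G z.1 s - expVal P G z.1)| ≤ ‖v‖ * (2 * νg) :=
        (abs_real_inner_le_norm _ _).trans
          (mul_le_mul_of_nonneg_left (hdiff _ hcO s) (norm_nonneg _))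
      have h2 : |inner ℝ (if ‖z.2‖ ≤ B then z.2 else 0) (G u s - expVal P G u)|
          ≤ B * (2 * νg) :=
        (abs_real_inner_le_norm _ _).trans
          (mul_le_mul (htr _) (hdiff _ (H.subset hu) s) (norm_nonneg _) hB)
      linarith
  all_goals
    have hcO := H.subset z.1.2
    have i1 : Integrable (fun s => F u s - expVal P F u) P :=
      (hFi u (H.subset hu)).sub (integrable_const _)
    have i2 : Integrable (fun s => F z.1 s - expVal P F z.1) P :=
      (hFi _ hcO).sub (integrable_const _)
    have i3 : Integrable (fun s => G z.1 s - expVal P G z.1) P :=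
      (hGi _ hcO).sub (integrable_const _)
    have i4 : Integrable (fun s => G u s - expVal P G u) P :=
      (hGi u (H.subset hu)).sub (integrable_const _)
    have i3' := (i3.const_inner (𝕜 := ℝ) v).neg
    have i4' := i4.const_inner (𝕜 := ℝ) (if ‖z.2‖ ≤ B then z.2 else 0)
  · exact (i1.sub i2).add (i3'.add i4')
  · have e1 : ∫ s, (F u s - expVal P F u) ∂P = 0 := by
      rw [integral_sub (hFi u (H.subset hu)) (integrable_const _)]; simp [expVal]
    have e2 : ∫ s, (F z.1 s - expVal P F z.1) ∂P = 0 := by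
      rw [integral_sub (hFi _ hcO) (integrable_const _)]; simp [expVal]
    have e3 : ∫ s, (G z.1 s - expVal P G z.1) ∂P = 0 := by
      rw [integral_sub (hGi _ hcO) (integrable_const _)]; simp [expVal]
    have e4 : ∫ s, (G u s - expVal P G u) ∂P = 0 := by
      rw [integral_sub (hGi u (H.subset hu)) (integrable_const _)]; simp [expVal]
    have e3' : ∫ s, inner ℝ v (G z.1 s - expVal P G z.1) ∂P = 0 := by
      rw [integral_inner i3, e3, inner_zero_right]
    have e4' : ∫ s, inner ℝ (if ‖z.2‖ ≤ B then z.2 else 0)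
        (G u s - expVal P G u) ∂P = 0 := by
      rw [integral_inner i4, e4, inner_zero_right]
    change ∫ s, (((F u s - expVal P F u) - (F z.1 s - expVal P F z.1))
      + (-inner ℝ v (G z.1 s - expVal P G z.1)
        + inner ℝ (if ‖z.2‖ ≤ B then z.2 else 0) (G u s - expVal P G u))) ∂P = 0
    have j1 : Integrable (fun s => (F u s - expVal P F u) - (F z.1 s - expVal P F z.1)) P :=
      i1.sub i2
    have j2 : Integrable (fun s => -inner ℝ v (G z.1 s - expVal P G z.1)) P := i3'
    have j3 : Integrable (fun s => -inner ℝ v (G z.1 s - expVal P G z.1)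
        + inner ℝ (if ‖z.2‖ ≤ B then z.2 else 0) (G u s - expVal P G u)) P := j2.add i4'
    rw [integral_add j1 j3, integral_sub i1 i2, integral_add j2 i4', integral_neg, e1,
      e2, e3', e4']
    simp

end Probability

/-! ### Matching the constants. -/

section MultiplierBound

/-- The level below which the multipliers stay with high probability. -/
noncomputable def multiplierBound (R νg κf κg ε₀ σ L : ℝ) : ℝ :=
  constKappa1 R κf ε₀ + constKappa3 R νg κg ε₀ + constKappa2 R νg κf κg ε₀ * σ
    + 16 * constBeta R νg κg ^ 2 / ε₀ * L

variable {R νg κf κg ε₀ σ L : ℝ}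

/-- All that is needed of the logarithm in `κ₃` is `1 - 1/x ≤ log x`. -/
theorem le_constKappa3 (hβ : 0 < constBeta R νg κg) (hε : 0 < ε₀) :
    2 * constBeta R νg κg + ε₀ / 4 + 8 * constBeta R νg κg ^ 2 / ε₀ ≤ constKappa3 R νg κg ε₀ := by
  unfold constKappa3
  set β := constBeta R νg κg
  have h := Real.one_sub_inv_le_log_of_pos (x := 32 * β ^ 2 / ε₀ ^ 2) (by positivity)
  have h1 := mul_le_mul_of_nonneg_left h (by positivity : 0 ≤ 8 * β ^ 2 / ε₀)
  have e1 : 8 * β ^ 2 / ε₀ * (1 - (32 * β ^ 2 / ε₀ ^ 2)⁻¹) = 8 * β ^ 2 / ε₀ - ε₀ / 4 := by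
    field_simp; ring
  have e2 : 8 * β ^ 2 * Real.log (32 * β ^ 2 / ε₀ ^ 2) / ε₀
    = 8 * β ^ 2 / ε₀ * Real.log (32 * β ^ 2 / ε₀ ^ 2) := by ring
  rw [e2]
  linarith

theorem multiplierBound_nonneg (hR : 0 ≤ R) (hκf : 0 ≤ κf) (hβ : 0 < constBeta R νg κg)
    (hε : 0 < ε₀) (hσ : 0 ≤ σ) (hσ1 : σ ≤ 1) (hL : 0 ≤ L) :
    0 ≤ multiplierBound R νg κf κg ε₀ σ L := by
  have h3 := le_constKappa3 hβ hε
  unfold multiplierBound constKappa1 constKappa2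
  set β := constBeta R νg κg
  have h1 : 0 ≤ (R ^ 2 + 2 * κf * R) / ε₀ := by positivity
  have h2 : 0 ≤ (κf ^ 2 + 2 * νg ^ 2 + 2 * κg ^ 2 * R ^ 2) / ε₀ * σ := by positivity
  have h4 : 0 ≤ 16 * β ^ 2 / ε₀ * L := by positivity
  have h5 : β * σ ≤ β := mul_le_of_le_one_right hβ.le hσ1
  have h6 : 0 ≤ 8 * β ^ 2 / ε₀ := by positivity
  linarith

/-- The `L`-free part of the level dominates `θ + 2β`; the `8β²/ε₀ ≥ 8β` hidden in `κ₃` pays for the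
`-β` in `κ₂`. The rate times `16β²/ε₀ * L` is exactly `4L`. -/
theorem drift_exponent_le (hβ : 0 < constBeta R νg κg) (hε : 0 < ε₀)
    (hεβ : ε₀ ≤ constBeta R νg κg) (hσ : 0 ≤ σ) (hσ1 : σ ≤ 1) :
    ε₀ / (4 * constBeta R νg κg ^ 2)
      * (((2 * (κf * R + σ / 2 * νg ^ 2) + R ^ 2) / ε₀ + ε₀) + 2 * constBeta R νg κg
        - multiplierBound R νg κf κg ε₀ σ L) ≤ -(4 * L) := by
  have h3 := le_constKappa3 hβ hε
  unfold multiplierBound constKappa1 constKappa2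
  set β := constBeta R νg κg
  have h1 : (2 * (κf * R + σ / 2 * νg ^ 2) + R ^ 2) / ε₀
      = (R ^ 2 + 2 * κf * R) / ε₀ + σ * νg ^ 2 / ε₀ := by ring
  have h2 : σ * νg ^ 2 / ε₀ ≤ (κf ^ 2 + 2 * νg ^ 2 + 2 * κg ^ 2 * R ^ 2) / ε₀ * σ := by
    rw [div_mul_eq_mul_div, mul_comm σ]
    gcongr
    nlinarith [sq_nonneg κf, sq_nonneg νg, sq_nonneg (κg * R)]
  have h5 : β * σ ≤ β := mul_le_of_le_one_right hβ.le hσ1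
  have h6 : 8 * β ≤ 8 * β ^ 2 / ε₀ := by
    rw [le_div_iff₀ hε]; nlinarith
  have h7 : ((2 * (κf * R + σ / 2 * νg ^ 2) + R ^ 2) / ε₀ + ε₀) + 2 * β
      - ((R ^ 2 + 2 * κf * R) / ε₀ + constKappa3 R νg κg ε₀
        + ((κf ^ 2 + 2 * νg ^ 2 + 2 * κg ^ 2 * R ^ 2) / ε₀ - β) * σ + 16 * β ^ 2 / ε₀ * L)
      ≤ -(16 * β ^ 2 / ε₀ * L) := by
    rw [h1]; linarith
  refine (mul_le_mul_of_nonneg_left h7 (by positivity)).trans (le_of_eq ?_)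
  field_simp
  ring

/-- The slack is explicit: `η + 1` stands in place of `η` in the step-length terms, and `ϱ₁` has a
surplus `β²/2 + 5νg²`. -/
theorem gap_bound_le_rho {νf η : ℝ} (hκf : 0 ≤ κf) (hκg : 0 ≤ κg) (hσ : 0 ≤ σ)
    (hB : 0 ≤ multiplierBound R νg κf κg ε₀ σ L) :
    σ * (νg ^ 2 + κf ^ 2 / 2)
      + η * κg * (σ * (κf + 1 + κg * multiplierBound R νg κf κg ε₀ σ L))
      + σ / 2 * (η ^ 2 + R ^ 2)
      + (2 * νf + 2 * νg * (η + multiplierBound R νg κf κg ε₀ σ L)) * (L * σ)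
    ≤ constRho1 R νg κf κg ε₀ η * σ + constRho2 R νf νg κf κg ε₀ η * (L * σ)
      + constRho3 R νg κg ε₀ * (L ^ 2 * σ) + constRho4 R νg κf κg ε₀ * (L * σ ^ 2)
      + constRho5 R νg κf κg ε₀ η * σ ^ 2 := by
  have h1 : 0 ≤ κg * (σ * (κf + 1 + κg * multiplierBound R νg κf κg ε₀ σ L)) := by positivity
  have h2 : 0 ≤ σ * (constBeta R νg κg ^ 2 / 2 + 5 * νg ^ 2) := by positivity
  rw [← sub_nonneg]
  have key : constRho1 R νg κf κg ε₀ η * σ + constRho2 R νf νg κf κg ε₀ η * (L * σ)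
      + constRho3 R νg κg ε₀ * (L ^ 2 * σ) + constRho4 R νg κf κg ε₀ * (L * σ ^ 2)
      + constRho5 R νg κf κg ε₀ η * σ ^ 2
      - (σ * (νg ^ 2 + κf ^ 2 / 2)
        + η * κg * (σ * (κf + 1 + κg * multiplierBound R νg κf κg ε₀ σ L))
        + σ / 2 * (η ^ 2 + R ^ 2)
        + (2 * νf + 2 * νg * (η + multiplierBound R νg κf κg ε₀ σ L)) * (L * σ))
      = κg * (σ * (κf + 1 + κg * multiplierBound R νg κf κg ε₀ σ L))
        + σ * (constBeta R νg κg ^ 2 / 2 + 5 * νg ^ 2) := by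
    unfold multiplierBound constRho1 constRho2 constRho3 constRho4 constRho5
    ring
  rw [key]
  exact add_nonneg h1 h2

end MultiplierBound

/-! ### The gap on the good event. -/

section Gap

variable {E V Ξ : Type*} [NormedAddCommGroup E] [InnerProductSpace ℝ E] [CompleteSpace E]
  [NormedAddCommGroup V] [InnerProductSpace ℝ V] [FiniteDimensional ℝ V] [MeasurableSpace Ξ]
  {F : E → Ξ → ℝ} {G : E → Ξ → V} {X O : Set E} {K : ProperCone ℝ V} {R νg κf κg σ : ℝ}
  {P : Measure Ξ} {x₁ : E} {ξ : ℕ → Ξ} {x : ℕ → E} {y : ℕ → V}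

/-- With every multiplier below `B` the truncation in `stepError` is inactive, so expected gaps are
sampled gaps plus noise. -/
theorem IsBoundedConvexSample.minimaxGap_le (H : IsBoundedConvexSample F G X O K R νg κf κg)
    (hrun : IsLSAALRun F G X K σ x₁ ξ x y) (hσ : 0 < σ) (hx₁ : x₁ ∈ X) {u : E} (hu : u ∈ X)
    {v : V} (hv : v ∈ polarCone K)
    (hconv : ConvexOn ℝ X (fun x => expVal P F x + inner ℝ v (expVal P G x)))
    (hg : ∀ x ∈ X, ‖expVal P G x‖ ≤ νg) {N : ℕ} (hN : 0 < N) {B M : ℝ}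
    (hB : ∀ k < N, ‖y k‖ ≤ B)
    (hM : ∑ k ∈ Finset.range N, stepError P F G B u v (x k) (y k) (ξ k) ≤ M) :
    minimaxGap (augLagrangian K σ (expVal P F) (expVal P G)) u v (avgIter N x) (avgIter N y)
      ≤ 1 / N * (N * (σ / 2 * (νg ^ 2 + κf ^ 2))
          + ‖v‖ * κg * (N * (σ * (κf + κg * (B + σ * νg))))
          + 1 / (2 * σ) * (‖v‖ ^ 2 + R ^ 2) + M) + σ / 2 * νg ^ 2 := by
  have hκg := (norm_nonneg _).trans (H.norm_fderiv_le (ξ 0) u (H.subset hu))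
  refine (minimaxGap_avgIter_le H.convex hσ hconv hg (hrun.x_mem' hx₁) hrun.y_mem hN).trans ?_
  gcongr
  have h1 := hrun.sum_saddle_le H hσ hx₁ hu hv N
  have h2 : ∑ k ∈ Finset.range N, (σ * (κf + κg * (‖y k‖ + σ * νg)))
      ≤ N * (σ * (κf + κg * (B + σ * νg))) := by
    calc _ ≤ ∑ k ∈ Finset.range N, (σ * (κf + κg * (B + σ * νg))) := by
          refine Finset.sum_le_sum fun k hk => ?_
          have := hB k (Finset.mem_range.1 hk)
          gcongr
      _ = _ := by simp
  have h3 := mul_le_mul_of_nonneg_left h2 (mul_nonneg (norm_nonneg v) hκg)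
  have h4 : ∑ k ∈ Finset.range N, (expVal P F (x k) + inner ℝ v (expVal P G (x k))
        - expVal P F u - inner ℝ (y k) (expVal P G u))
      = ∑ k ∈ Finset.range N, (F (x k) (ξ k) - F u (ξ k) + inner ℝ v (G (x k) (ξ k))
          - inner ℝ (y k) (G u (ξ k)))
        + ∑ k ∈ Finset.range N, stepError P F G B u v (x k) (y k) (ξ k) := by
    rw [← Finset.sum_add_distrib]
    refine Finset.sum_congr rfl fun k hk => ?_
    rw [stepError, if_pos (hB k (Finset.mem_range.1 hk)), inner_sub_right, inner_sub_right]
    ring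
  rw [h4]
  linarith

end Gap

/-! ### Failure probability and conclusion. -/

theorem one_sub_le_one_sub_failure {N : ℕ} (hN : 0 < N) :
    1 - 5 / (N : ℝ) ^ (1 / 3 : ℝ) ≤ 1 - ((N : ℝ) ^ 2 * Real.exp (-(4 * Real.log N))
      + Real.exp (2 - Real.log N)) ∨ 1 - 5 / (N : ℝ) ^ (1 / 3 : ℝ) ≤ 0 := by
  have hN0 : (0 : ℝ) < N := by exact_mod_cast hN
  set c := (N : ℝ) ^ (1 / 3 : ℝ) with hc
  have hc0 : 0 < c := by positivity
  have hcN : c ^ 3 = N := by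
    rw [hc, ← Real.rpow_natCast, ← Real.rpow_mul hN0.le]; norm_num
  -- If `N^(1/3) ≤ 5` the claimed probability is nonpositive; otherwise the failures sum to at most
  -- `10/N`, which is below `5/N^(1/3)`.
  rcases le_or_gt c 5 with h5 | h5
  · right
    rw [sub_nonpos, le_div_iff₀ hc0]; linarith
  left
  have e1 : (N : ℝ) ^ 2 * Real.exp (-(4 * Real.log N)) = 1 / (N : ℝ) ^ 2 := by
    have : Real.exp (4 * Real.log N) = (N : ℝ) ^ 4 := by
      rw [show 4 * Real.log N = ((4 : ℕ) : ℝ) * Real.log N by norm_num, Real.exp_nat_mul,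
        Real.exp_log hN0]
    rw [Real.exp_neg, this]; field_simp
  have e2 : Real.exp (2 - Real.log N) ≤ 9 / N := by
    rw [Real.exp_sub, Real.exp_log hN0]
    gcongr
    have : Real.exp 2 = Real.exp 1 * Real.exp 1 := by rw [← Real.exp_add]; norm_num
    rw [this]
    nlinarith [Real.exp_one_lt_three, Real.exp_pos 1]
  rw [e1]
  have h1 : 1 / (N : ℝ) ^ 2 ≤ 1 / N := by
    have hN1 : (1 : ℝ) ≤ N := by exact_mod_cast hN
    apply one_div_le_one_div_of_le hN0; nlinarith
  have h2 : 10 / (N : ℝ) ≤ 5 / c := by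
    rw [div_le_div_iff₀ hN0 hc0, ← hcN]
    nlinarith [mul_pos hc0 hc0]
  have h3 : 10 / (N : ℝ) = 1 / N + 9 / N := by ring
  linarith

theorem theorem3p2
    {n : ℕ}
    {V : Type*} [NormedAddCommGroup V] [InnerProductSpace ℝ V] [FiniteDimensional ℝ V]
    {Ξ : Type*} [MeasurableSpace Ξ] (P : Measure Ξ) [IsProbabilityMeasure P]
    {Ω : Type*} [MeasurableSpace Ω] (μ : Measure Ω) [IsProbabilityMeasure μ]
    -- the stochastic convex conic problem
    (X O : Set (EuclideanSpace ℝ (Fin n))) (K : ProperCone ℝ V)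
    (F : EuclideanSpace ℝ (Fin n) → Ξ → ℝ) (G : EuclideanSpace ℝ (Fin n) → Ξ → V)
    (hX : IsCompact X) (hXc : Convex ℝ X) (hO : IsOpen O) (hOc : Convex ℝ O) (hXO : X ⊆ O)
    (hFm : ∀ x ∈ O, StronglyMeasurable (F x)) (hGm : ∀ x ∈ O, StronglyMeasurable (G x))
    (hFi : ∀ x ∈ O, Integrable (F x) P)
    (hFc : ∀ s, ConvexOn ℝ O (fun x => F x s))
    (hGc : ∀ s, IsGraphConvexOn K O (fun x => G x s))
    (hFs : ∀ s, ContDiffOn ℝ 1 (fun x => F x s) O)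
    (hGs : ∀ s, ContDiffOn ℝ 1 (fun x => G x s) O)
    -- i.i.d. samples with law `P`
    (ξ : ℕ → Ω → Ξ) (hξm : ∀ k, Measurable (ξ k)) (hξ : ∀ k, HasLaw (ξ k) P μ) (hind : iIndepFun ξ μ)
    -- unbiased stochastic gradients and derivatives
    (hC1f : ∀ x ∈ O,
      HasGradientAt (expVal P F) (∫ s, gradient (fun u => F u s) x ∂P) x)
    (hC1g : ∀ x ∈ O,
      HasFDerivAt (expVal P G) (∫ s, fderiv ℝ (fun u => G u s) x ∂P) x)
    -- bound on the diameter of `X`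
    (R : ℝ) (hR : 0 < R) (hD1 : ∀ x ∈ X, ∀ x' ∈ X, ‖x - x'‖ ≤ R)
    -- bound on the constraint values
    (νg : ℝ) (hνg : 0 < νg) (hD2 : ∀ s, ∀ x ∈ O, ‖G x s‖ ≤ νg)
    -- bounds on the stochastic gradients and derivatives
    (κf κg : ℝ) (hκf : 0 < κf) (hκg : 0 < κg)
    (hD3f : ∀ s, ∀ x ∈ O, ‖gradient (fun u => F u s) x‖ ≤ κf)
    (hD3g : ∀ s, ∀ x ∈ O, ‖fderiv ℝ (fun u => G u s) x‖ ≤ κg)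
    -- Slater point, with a radius `ε₀` witnessing that its image is interior to `K`
    (xhat : EuclideanSpace ℝ (Fin n)) (hxhat : xhat ∈ interior X)
    (ε₀ : ℝ) (hε₀ : 0 < ε₀) (hD4 : Metric.closedBall (expVal P G xhat) ε₀ ⊆ (K : Set V))
    -- light tail of `F`
    (νf : ℝ) (hνf : 0 < νf)
    (hD5 : ∀ x ∈ X,
      Integrable (fun s => Real.exp (|F x s - expVal P F x| ^ 2 / νf ^ 2)) P ∧
      ∫ s, Real.exp (|F x s - expVal P F x| ^ 2 / νf ^ 2) ∂P ≤ Real.exp 1)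
    -- number of iterations and parameter
    (N : ℕ) (hN : νg ^ 2 * max (κg ^ 2) 1 < (N : ℝ))
    (σ : ℝ) (hσ : σ = 1 / √(N : ℝ))
    -- the iterates
    (x₁ : EuclideanSpace ℝ (Fin n)) (hx₁ : x₁ ∈ X)
    (x : ℕ → Ω → EuclideanSpace ℝ (Fin n)) (y : ℕ → Ω → V)
    (hrun : ∀ ω, IsLSAALRun F G X K σ x₁
      (fun k => ξ k ω) (fun k => x k ω) (fun k => y k ω))
    -- a saddle point of the augmented Lagrangian
    (xs : EuclideanSpace ℝ (Fin n)) (ys : V)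
    (hs : IsSaddlePt X (polarCone K) (augLagrangian K σ (expVal P F) (expVal P G)) xs ys) :
    1 - 5 / (N : ℝ) ^ (1 / 3 : ℝ) ≤
      μ.real {ω |
        minimaxGap (augLagrangian K σ (expVal P F) (expVal P G)) xs ys
            (avgIter N (fun k => x k ω)) (avgIter N (fun k => y k ω)) ≤
          constRho1 R νg κf κg ε₀ ‖ys‖ * (1 / √(N : ℝ))
          + constRho2 R νf νg κf κg ε₀ ‖ys‖ * (Real.log N / √(N : ℝ))
          + constRho3 R νg κg ε₀ * (Real.log N ^ 2 / √(N : ℝ))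
          + constRho4 R νg κf κg ε₀ * (Real.log N / N)
          + constRho5 R νg κf κg ε₀ ‖ys‖ * (1 / (N : ℝ))} := by
  let _ : MeasurableSpace V := borel V
  have : BorelSpace V := ⟨rfl⟩
  have : ProperSpace V := FiniteDimensional.proper ℝ V
  have H : IsBoundedConvexSample F G X O K R νg κf κg :=
    ⟨hXc, hO, hOc, hXO, hFc, hGc, hFs, hGs, hD1, hD2, hD3f, hD3g⟩
  have hN0 : (0 : ℝ) < N := lt_of_le_of_lt (by positivity) hN
  have hNpos : 0 < N := by exact_mod_cast hN0
  have hN1 : (1 : ℝ) ≤ N := by exact_mod_cast hNpos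
  have hsq : 0 < √(N : ℝ) := Real.sqrt_pos.2 hN0
  have hsqN : √(N : ℝ) ^ 2 = N := Real.sq_sqrt hN0.le
  have hσ0 : 0 < σ := by rw [hσ]; positivity
  have hσ1 : σ ≤ 1 := by
    rw [hσ, div_le_one hsq]; exact Real.one_le_sqrt.2 hN1
  have hL : 0 ≤ Real.log N := Real.log_nonneg hN1
  -- The lower bound on `N` enters here, producing the `+ 1` next to `κf` in `ϱ₁`.
  have hκσ : κg * (σ * νg) ≤ 1 := by
    have h1 : κg * νg ≤ √(N : ℝ) := by
      refine Real.le_sqrt_of_sq_le (le_trans ?_ hN.le)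
      rw [mul_pow, mul_comm]
      exact mul_le_mul_of_nonneg_left (le_max_left _ _) (by positivity)
    have e : κg * (σ * νg) = κg * νg / √(N : ℝ) := by rw [hσ]; ring
    rw [e, div_le_one hsq]; exact h1
  have hνβ : νg ≤ constBeta R νg κg := by
    unfold constBeta; nlinarith [mul_pos hκg hR]
  have hβ : 0 < constBeta R νg κg := hνg.trans_le hνβ
  have hFm' : ∀ x ∈ O, Measurable (F x) := fun x hx => (hFm x hx).measurable
  have hGm' : ∀ x ∈ O, Measurable (G x) := fun x hx => (hGm x hx).measurable
  have hGi : ∀ c ∈ O, Integrable (G c) P := fun c hc =>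
    Integrable.of_bound (hGm c hc).aestronglyMeasurable νg
      (Filter.Eventually.of_forall fun s => hD2 s c hc)
  have hgn : ∀ c ∈ O, ‖expVal P G c‖ ≤ νg := fun c hc =>
    (norm_integral_le_of_norm_le_const (μ := P)
      (Filter.Eventually.of_forall fun s => hD2 s c hc)).trans (by simp)
  have hxX : xhat ∈ X := interior_subset hxhat
  obtain ⟨hxs, hys, -⟩ := hs
  set B := multiplierBound R νg κf κg ε₀ σ (Real.log N) with hBdef
  have hB : 0 ≤ B := multiplierBound_nonneg hR.le hκf.le hβ hε₀ hσ0.le hσ1 hL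
  set M := (2 * νf + 2 * νg * (‖ys‖ + B)) * √(N : ℝ) * Real.log N with hM
  -- The strict inequality makes the complement match the truncation, and the event empty when all
  -- multipliers vanish.
  let bad₁ : Set Ω := {ω | ∃ k < N, B < ‖y k ω‖}
  let bad₂ : Set Ω := {ω | M
    ≤ ∑ k ∈ Finset.range N, stepError P F G B xs ys (x k ω) (y k ω) (ξ k ω)}
  have hbad₁ : μ.real bad₁ ≤ (N : ℝ) ^ 2 * Real.exp (-(4 * Real.log N)) := by
    refine ENNReal.toReal_le_of_le_ofReal (by positivity) ?_
    -- The drift argument needs `ε₀ ≤ β₀`. If `ε₀ > νg`, the Slater inequality `⟨y, g xhat⟩ ≤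
    -- -ε₀‖y‖` contradicts Cauchy–Schwarz unless `y = 0`.
    rcases le_or_gt ε₀ νg with hcase | hcase
    · have h1 := H.measure_exists_le_norm_y hFm' hGm' hσ0 hσ1 hx₁ hrun hξm hξ hind hR.le hνg.le
        hκf.le hxX hε₀ hD4 (hcase.trans hνβ) hνβ N B
      refine (measure_mono ?_).trans (h1.trans ?_)
      · rintro ω ⟨k, hk, hω⟩
        exact ⟨k, hk, hω.le⟩
      refine ENNReal.ofReal_le_ofReal ?_
      gcongr
      exact drift_exponent_le hβ hε₀ (hcase.trans hνβ) hσ0.le hσ1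
    · have h1 : bad₁ = ∅ := by
        refine Set.eq_empty_of_forall_notMem fun ω ⟨k, _, hω⟩ => ?_
        have h2 := inner_le_of_closedBall_subset hε₀ hD4 ((hrun ω).y_mem k)
        have h3 := neg_le_of_abs_le (abs_real_inner_le_norm (y k ω) (expVal P G xhat))
        have h4 := mul_le_mul_of_nonneg_left (hgn xhat (hXO hxX)) (norm_nonneg (y k ω))
        have h5 : 0 < ‖y k ω‖ := hB.trans_lt hω
        nlinarith
      simp [h1]
  have hbad₂ : μ.real bad₂ ≤ Real.exp (2 - Real.log N) := by
    refine ENNReal.toReal_le_of_le_ofReal (Real.exp_pos _).le ?_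
    refine H.measure_sum_stepError hFm' hGm' hσ0 hx₁ hrun hξm hξ hind hFi
      (fun c hc => (hC1f c (hXO hc)).continuousAt.continuousWithinAt)
      (fun c hc => (hC1g c (hXO hc)).continuousAt.continuousWithinAt) hνg.le hνf
      (fun c hc => ?_) hxs ys hB hNpos (Real.log N)
    simpa only [IsLightTailed, sq_abs] using hD5 c hc
  have hconv := (convexOn_expVal_add_inner hOc hFi hGi hFc hGc hys).subset hXO hXc
  set good : Set Ω := {ω | minimaxGap (augLagrangian K σ (expVal P F) (expVal P G)) xs ys
    (avgIter N (fun k => x k ω)) (avgIter N (fun k => y k ω)) ≤ _} with hgood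
  have hcover : Set.univ ⊆ good ∪ (bad₁ ∪ bad₂) := by
    intro ω _
    by_cases h1 : ω ∈ bad₁
    · exact Or.inr (Or.inl h1)
    by_cases h2 : ω ∈ bad₂
    · exact Or.inr (Or.inr h2)
    left
    have h1' : ∀ k < N, ‖y k ω‖ ≤ B := fun k hk => not_lt.1 fun h => h1 ⟨k, hk, h⟩
    have h2' : ∑ k ∈ Finset.range N, stepError P F G B xs ys (x k ω) (y k ω) (ξ k ω) ≤ M :=
      (not_le.1 h2).le
    refine (H.minimaxGap_le (hrun ω) hσ0 hx₁ hxs hys hconv (fun c hc => hgn c (hXO hc)) hNpos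
      h1' h2').trans ?_
    have hrho := gap_bound_le_rho (νf := νf) (η := ‖ys‖) hκf.le hκg.le hσ0.le hB
    have e1 : 1 / √(N : ℝ) = σ := hσ.symm
    have e2 : Real.log N / √(N : ℝ) = Real.log N * σ := by rw [hσ]; ring
    have e3 : Real.log N ^ 2 / √(N : ℝ) = Real.log N ^ 2 * σ := by rw [hσ]; ring
    have e5 : 1 / (N : ℝ) = σ ^ 2 := by rw [hσ, div_pow, hsqN, one_pow]
    have e4 : Real.log N / (N : ℝ) = Real.log N * σ ^ 2 := by rw [← e5]; ring
    rw [e1, e2, e3, e4, e5]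
    refine le_trans ?_ hrho
    have hNσ : σ ^ 2 * N = 1 := by rw [← e5]; field_simp
    have e6 : σ ^ 2 * M = (2 * νf + 2 * νg * (‖ys‖ + B)) * (Real.log N * σ) := by
      have : σ * √(N : ℝ) = 1 := by rw [hσ]; field_simp
      rw [hM]
      linear_combination ((2 * νf + 2 * νg * (‖ys‖ + B)) * Real.log N * σ) * this
    have e7 : σ ^ 2 * (1 / (2 * σ) * (‖ys‖ ^ 2 + R ^ 2)) = σ / 2 * (‖ys‖ ^ 2 + R ^ 2) := by
      field_simp
    have e8 : σ ^ 2 * (N * (σ / 2 * (νg ^ 2 + κf ^ 2))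
          + ‖ys‖ * κg * (N * (σ * (κf + κg * (B + σ * νg))))
          + 1 / (2 * σ) * (‖ys‖ ^ 2 + R ^ 2) + M)
        = σ / 2 * (νg ^ 2 + κf ^ 2) + ‖ys‖ * κg * (σ * (κf + κg * (B + σ * νg)))
          + σ / 2 * (‖ys‖ ^ 2 + R ^ 2)
          + (2 * νf + 2 * νg * (‖ys‖ + B)) * (Real.log N * σ) := by
      rw [← e6, ← e7]
      linear_combination (σ / 2 * (νg ^ 2 + κf ^ 2)
        + ‖ys‖ * κg * (σ * (κf + κg * (B + σ * νg)))) * hNσ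
    rw [e8]
    have h3 : ‖ys‖ * κg * (σ * (κf + κg * (B + σ * νg)))
        ≤ ‖ys‖ * κg * (σ * (κf + 1 + κg * B)) := by
      refine mul_le_mul_of_nonneg_left (mul_le_mul_of_nonneg_left ?_ hσ0.le) (by positivity)
      linarith
    linarith
  -- Subadditivity over a cover requires no measurability of these events.
  have hprob : 1 ≤ μ.real good + (μ.real bad₁ + μ.real bad₂) := by
    calc (1 : ℝ) = μ.real Set.univ := by simp
      _ ≤ μ.real (good ∪ (bad₁ ∪ bad₂)) := measureReal_mono hcover
      _ ≤ μ.real good + μ.real (bad₁ ∪ bad₂) := measureReal_union_le _ _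
      _ ≤ _ := by gcongr; exact measureReal_union_le _ _
  rcases one_sub_le_one_sub_failure hNpos with h | h
  · linarith
  · exact h.trans measureReal_nonneg
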